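/- Let $F$ be a non-Archimedean local field with ring of integers $\mathcal O$, uniformiser $\varpi$ and residue field $k$ of characteristic $p$, let $n\ge 0$, and let $R$ be an algebraically closed field of characteristic $l\neq p$. Put $G=\mathrm{GL}_n(F)$, $K=\mathrm{GL}_n(\mathcal O)$, $K^1=1+\varpi M_n(\mathcal O)\subseteq K$ and $G_f=\mathrm{GL}_n(k)=K/K^1$. Let $B_f\subseteq G_f$ be the subgroup of upper triangular matrices and $I\subseteq K$ its preimage. Let $\mathcal H(G)$ be the algebra of locally constant, compactly supported functions $G\to R$ under convolution with respect to the $R$-valued Haar measure on $G$ giving $K^1$ volume $1$; let $\mathcal H(K)\subseteq\mathcal H(G)$ be the subalgebra of functions supported on $K$, and let $\mathcal H(G_f)=R[G_f]$. View $\mathcal H(G_f)$ as a left $\mathcal H(K)$-module through the homomorphism $\mathcal H(K)\to\mathcal H(G_f)$, $f\mapsto 1_{K^1}f1_{K^1}$, where $1_{gK^1}$ ($g\in K$) is identified with the image of $g$ in $G_f$. Let $\mathcal I$ be the annihilator in $\mathcal H(G)$ of the compactly induced representation $\mathrm{ind}_I^G\mathbf 1$, and let $\mathcal I_f$ be the annihilator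 in $\mathcal H(G_f)$ of $\mathrm{ind}_{B_f}^{G_f}\mathbf 1$. Then $$\mathcal H(G)\otimes_{\mathcal H(K)}\mathcal I_f=\mathcal I\otimes_{\mathcal H(K)}\mathcal H(G_f)$$ as subsets of $\mathcal H(G)\otimes_{\mathcal H(K)}\mathcal H(G_f)$, where the left (right) side denotes the subspace spanned by the $f\otimes z$ with $f\in\mathcal H(G)$, $z\in\mathcal I_f$ (with $f\in\mathcal I$, $z\in\mathcal H(G_f)$). -/

import Mathlib

open scoped ValuativeRel TensorProduct Pointwise

noncomputable section

namespace Hecke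

section General

variable (R : Type*) [Field R] {G : Type*} [Group G] [TopologicalSpace G]

/-- The integral of a locally constant compactly supported function `φ : G → V`, for the
`R`-valued left Haar measure on `G` that gives the compact open subgroup `U₀` volume `1`:
if `φ` is right invariant under an open subgroup `U ≤ U₀`, it is
`[U₀ : U]⁻¹ ∑_{x ∈ G/U} φ(x)`. (It does not depend on `U`, see `haarIntegral_eq`.) -/
def haarIntegral (U₀ : Subgroup G) {V : Type*} [AddCommGroup V] [Module R V] (φ : G → V) : V :=
  open Classical in
  if h : ∃ U : Subgroup G, IsOpen (U : Set G) ∧ U ≤ U₀ ∧ ∀ g, ∀ u ∈ U, φ (g * u) = φ g then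
    ((h.choose.relIndex U₀ : ℕ) : R)⁻¹ • ∑ᶠ x : G ⧸ h.choose, φ x.out
  else 0

/-- The space of locally constant, compactly supported functions `G → R`. -/
def heckeSubmodule (G : Type*) [Group G] [TopologicalSpace G] : Submodule R (G → R) where
  carrier := {f | IsLocallyConstant f ∧ HasCompactSupport f}
  zero_mem' := ⟨IsLocallyConstant.const 0, HasCompactSupport.zero⟩
  add_mem' hf hg := ⟨hf.1.add hg.1, hf.2.add hg.2⟩
  smul_mem' c _ hf := ⟨hf.1.comp (c • ·), hf.2.smul_left (f := fun _ => c)⟩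

/-- The global Hecke algebra `H(G)` of locally constant, compactly supported functions `G → R`.
Its product is the convolution `HeckeAlgebra.mul`. -/
def HeckeAlgebra (G : Type*) [Group G] [TopologicalSpace G] : Type _ := heckeSubmodule R G

instance (G : Type*) [Group G] [TopologicalSpace G] : AddCommGroup (HeckeAlgebra R G) :=
  inferInstanceAs (AddCommGroup (heckeSubmodule R G))

instance (G : Type*) [Group G] [TopologicalSpace G] : Module R (HeckeAlgebra R G) :=
  inferInstanceAs (Module R (heckeSubmodule R G))

/-- Convolution of functions on `G`: `(f * h)(x) = ∫ f(g) h(g⁻¹ x) dg`, where the Haar measure is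
normalised by `vol(U₀) = 1`. -/
def convolution (U₀ : Subgroup G) (f h : G → R) (x : G) : R :=
  haarIntegral R U₀ fun g => f g * h (g⁻¹ * x)

/-- The action of a function `f` on `G` on a vector `v` of a representation `ρ` of `G`:
`f v = ∫ f(g) ρ(g) v dg`. -/
def act (U₀ : Subgroup G) {V : Type*} [AddCommGroup V] [Module R V] (ρ : Representation R G V)
    (f : G → R) (v : V) : V :=
  haarIntegral R U₀ fun g => f g • ρ g v

/-- The annihilator in the Hecke algebra of a (smooth) representation of `G`. -/
def annihilator (U₀ : Subgroup G) {V : Type*} [AddCommGroup V] [Module R V]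
    (ρ : Representation R G V) : Set (HeckeAlgebra R G) :=
  {f | ∀ v, act R U₀ ρ f.1 v = 0}

variable {R}

/-- The integral may be computed with any open subgroup `U ≤ U₀` under which the function is right
invariant, as soon as the indices of open subgroups in `U₀` are finite and invertible in `R`
(for instance if `U₀` is a pro-`p` group and `p` is invertible in `R`). -/
theorem haarIntegral_eq [IsTopologicalGroup G] (U₀ : Subgroup G)
    (hU₀ : ∀ U : Subgroup G, IsOpen (U : Set G) → U ≤ U₀ → ((U.relIndex U₀ : ℕ) : R) ≠ 0)
    {V : Type*} [AddCommGroup V] [Module R V] (φ : G → V) (hφ : HasCompactSupport φ)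
    (U : Subgroup G) (hU : IsOpen (U : Set G)) (hUU₀ : U ≤ U₀)
    (hinv : ∀ g, ∀ u ∈ U, φ (g * u) = φ g) :
    haarIntegral R U₀ φ = ((U.relIndex U₀ : ℕ) : R)⁻¹ • ∑ᶠ x : G ⧸ U, φ x.out := by
  have out_eq : ∀ (W : Subgroup G), (∀ g, ∀ u ∈ W, φ (g * u) = φ g) →
      ∀ g : G, φ (g : G ⧸ W).out = φ g := by
    intro W hW g
    obtain ⟨h, hh⟩ := QuotientGroup.mk_out_eq_mul W g
    rw [hh, hW g _ h.2]
  have fin : ∀ (W : Subgroup G), IsOpen (W : Set G) → (∀ g, ∀ u ∈ W, φ (g * u) = φ g) →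
      (Function.support fun x : G ⧸ W => φ x.out).Finite := by
    intro W hWo hW
    have : DiscreteTopology (G ⧸ W) := QuotientGroup.discreteTopology hWo
    have hc : IsCompact ((fun g : G => (g : G ⧸ W)) '' tsupport φ) :=
      hφ.isCompact.image QuotientGroup.continuous_mk
    refine (isCompact_iff_finite.mp hc).subset ?_
    intro x hx
    exact ⟨x.out, subset_tsupport _ hx, by simp⟩
  have step : ∀ (W W' : Subgroup G), IsOpen (W : Set G) → IsOpen (W' : Set G) → W' ≤ W →
      W ≤ U₀ → (∀ g, ∀ u ∈ W, φ (g * u) = φ g) →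
      ((W'.relIndex U₀ : ℕ) : R)⁻¹ • ∑ᶠ x : G ⧸ W', φ x.out =
      ((W.relIndex U₀ : ℕ) : R)⁻¹ • ∑ᶠ x : G ⧸ W, φ x.out := by
    intro W W' hWo hWo' hle hWU hW
    have hW' : ∀ g, ∀ u ∈ W', φ (g * u) = φ g := fun g u hu => hW g u (hle hu)
    have hmul : W'.relIndex W * W.relIndex U₀ = W'.relIndex U₀ :=
      Subgroup.relIndex_mul_relIndex _ _ _ hle hWU
    have hne := hU₀ W' hWo' (hle.trans hWU)
    rw [← hmul, Nat.cast_mul] at hne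
    have hi : W'.relIndex W ≠ 0 := by
      intro h0; simp [h0] at hne
    have : Finite (W ⧸ W'.subgroupOf W) := Nat.finite_of_card_ne_zero hi
    let e := Subgroup.quotientEquivProdOfLE hle
    have key : ∀ a, φ a.out = φ (e a).1.out := by
      intro a
      induction a using QuotientGroup.induction_on with
      | H g => rw [out_eq W' hW']; exact (out_eq W hW g).symm
    have h1 : ∑ᶠ x : G ⧸ W', φ x.out = ∑ᶠ y : (G ⧸ W) × (W ⧸ W'.subgroupOf W), φ y.1.out :=
      finsum_eq_of_bijective e e.bijective key
    have h2 : (Function.support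
        fun y : (G ⧸ W) × (W ⧸ W'.subgroupOf W) => φ y.1.out).Finite := by
      refine ((fin W hWo hW).prod (Set.finite_univ (α := W ⧸ W'.subgroupOf W))).subset ?_
      intro y hy
      exact ⟨hy, trivial⟩
    have h3 : ∀ v : V, ∑ᶠ _ : W ⧸ W'.subgroupOf W, v = ((W'.relIndex W : ℕ) : R) • v := by
      intro v
      have := Fintype.ofFinite (W ⧸ W'.subgroupOf W)
      rw [finsum_eq_sum_of_fintype, Finset.sum_const, Finset.card_univ, Nat.cast_smul_eq_nsmul,
        ← Nat.card_eq_fintype_card]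
      rfl
    rw [h1, finsum_curry _ h2]
    simp only [h3]
    rw [← smul_finsum' _ (fin W hWo hW), smul_smul, ← hmul, Nat.cast_mul, mul_inv_rev, mul_assoc,
      inv_mul_cancel₀ (left_ne_zero_of_mul hne), mul_one]
  have h : ∃ U : Subgroup G, IsOpen (U : Set G) ∧ U ≤ U₀ ∧ ∀ g, ∀ u ∈ U, φ (g * u) = φ g :=
    ⟨U, hU, hUU₀, hinv⟩
  obtain ⟨ho, hl, hi⟩ := h.choose_spec
  have ho' : IsOpen ((h.choose ⊓ U : Subgroup G) : Set G) := by
    rw [Subgroup.coe_inf]; exact ho.inter hU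
  rw [haarIntegral, dif_pos h, ← step h.choose _ ho ho' inf_le_left hl hi,
    ← step U _ hU ho' inf_le_right hUU₀ hinv]

theorem convolution_mem [IsTopologicalGroup G] (U₀ : Subgroup G) {f h : G → R}
    (hf : f ∈ heckeSubmodule R G) (hh : h ∈ heckeSubmodule R G) :
    convolution R U₀ f h ∈ heckeSubmodule R G := by
  have int_zero : haarIntegral R U₀ (fun _ : G => (0 : R)) = 0 := by
    rw [haarIntegral]; split_ifs <;> simp
  constructor
  · rw [IsLocallyConstant.iff_eventually_eq]
    intro x₀
    have hop : IsOpen {y : G × G | h (y.1⁻¹ * y.2) = h (y.1⁻¹ * x₀)} := by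
      have hlc : IsLocallyConstant fun y : G × G => (h (y.1⁻¹ * y.2), h (y.1⁻¹ * x₀)) :=
        (hh.1.comp_continuous (f := fun y : G × G => y.1⁻¹ * y.2) (by fun_prop)).prodMk
          (hh.1.comp_continuous (f := fun y : G × G => y.1⁻¹ * x₀) (by fun_prop))
      exact hlc {p : R × R | p.1 = p.2}
    obtain ⟨u, v, -, hv, hu, hxv, huv⟩ := generalized_tube_lemma hf.2.isCompact
      (isCompact_singleton (x := x₀)) hop (by
        rintro ⟨a, b⟩ ⟨-, hb⟩
        simp only [Set.mem_singleton_iff] at hb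
        simp [hb])
    filter_upwards [hv.mem_nhds (hxv rfl)] with x hx
    unfold convolution
    congr 1
    funext g
    by_cases hg : f g = 0
    · simp [hg]
    · have : (g, x) ∈ {y : G × G | h (y.1⁻¹ * y.2) = h (y.1⁻¹ * x₀)} :=
        huv ⟨hu (subset_tsupport _ hg), hx⟩
      rw [show h (g⁻¹ * x) = h (g⁻¹ * x₀) from this]
  · refine HasCompactSupport.intro (hf.2.isCompact.mul hh.2.isCompact) ?_
    intro x hx
    have : (fun g => f g * h (g⁻¹ * x)) = fun _ => 0 := by
      funext g
      by_contra hne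
      refine hx ⟨g, subset_tsupport _ (left_ne_zero_of_mul hne), g⁻¹ * x,
        subset_tsupport _ (right_ne_zero_of_mul hne), by simp⟩
    rw [convolution, this, int_zero]

/-- The product of the Hecke algebra. -/
def HeckeAlgebra.mul [IsTopologicalGroup G] (U₀ : Subgroup G) (f h : HeckeAlgebra R G) :
    HeckeAlgebra R G :=
  ⟨convolution R U₀ f.1 h.1, convolution_mem U₀ f.2 h.2⟩

variable (R)

/-- The space of the compactly induced representation `ind_H^G 1`: functions `φ : G → R` with
`φ (g h) = φ g` for `h ∈ H`, smooth under left translation and compactly supported modulo `H`. -/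
def CompactInd (H : Subgroup G) [IsTopologicalGroup G] : Submodule R (G → R) where
  carrier := {φ | (∀ g, ∀ h ∈ H, φ (g * h) = φ g) ∧
    (∃ V : Subgroup G, IsOpen (V : Set G) ∧ ∀ v ∈ V, ∀ g, φ (v * g) = φ g) ∧
    ∃ C : Set G, IsCompact C ∧ Function.support φ ⊆ C * (H : Set G)}
  zero_mem' := ⟨fun _ _ _ => rfl, ⟨⊤, isOpen_univ, fun _ _ _ => rfl⟩, ∅, isCompact_empty, by simp⟩
  add_mem' := by
    rintro φ ψ ⟨h1, ⟨V, hV, hV'⟩, C, hC, hC'⟩ ⟨k1, ⟨W, hW, hW'⟩, D, hD, hD'⟩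
    refine ⟨fun g h hh => by simp [h1 g h hh, k1 g h hh], ⟨V ⊓ W, ?_, ?_⟩, C ∪ D, hC.union hD, ?_⟩
    · rw [Subgroup.coe_inf]; exact hV.inter hW
    · intro v hv g
      simp [hV' v hv.1 g, hW' v hv.2 g]
    · rw [Set.union_mul]
      exact (Function.support_add φ ψ).trans (Set.union_subset_union hC' hD')
  smul_mem' := by
    rintro c φ ⟨h1, ⟨V, hV, hV'⟩, C, hC, hC'⟩
    refine ⟨fun g h hh => by simp [h1 g h hh], ⟨V, hV, fun v hv g => by simp [hV' v hv g]⟩,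
      C, hC, (Function.support_const_smul_subset c φ).trans hC'⟩

/-- The compactly induced representation `ind_H^G 1`: `G` acts on `CompactInd R H` by left
translation, `(g φ)(x) = φ (g⁻¹ x)`. -/
def compactInd [IsTopologicalGroup G] (H : Subgroup G) :
    Representation R G (CompactInd R H) where
  toFun g :=
    { toFun := fun φ => ⟨fun x => φ.1 (g⁻¹ * x), by
        obtain ⟨φ, h1, ⟨V, hV, hV'⟩, C, hC, hC'⟩ := φ
        refine ⟨fun x h hh => by simp [← mul_assoc, h1 _ h hh],
          ⟨V.comap (MulAut.conj g⁻¹).toMonoidHom, ?_, ?_⟩, g • C, hC.smul g, ?_⟩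
        · exact hV.preimage (f := fun x => MulAut.conj g⁻¹ x) (by simp only [MulAut.conj_apply]; fun_prop)
        · intro v hv x
          have := hV' _ (Subgroup.mem_comap.mp hv) (g⁻¹ * x)
          simpa [mul_assoc] using this
        · intro x hx
          obtain ⟨c, hc, h, hh, hch⟩ := hC' (show g⁻¹ * x ∈ Function.support φ from hx)
          refine ⟨g * c, ⟨c, hc, rfl⟩, h, hh, ?_⟩
          simp only at hch
          simp [mul_assoc, hch]⟩
      map_add' := fun _ _ => rfl
      map_smul' := fun _ _ => rfl }
  map_one' := by ext; simp
  map_mul' g h := by ext; simp [mul_assoc]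

end General

section GLn

variable (F : Type*) [Field F] [ValuativeRel F] [TopologicalSpace F] [IsNonarchimedeanLocalField F]
  (n : ℕ)

/-- The group `G = GL_n(F)`. -/
abbrev GLF := Matrix.GeneralLinearGroup (Fin n) F

/-- The finite group `G_f = GL_n(k)`, with `k` the residue field of `F`. -/
abbrev GLk := Matrix.GeneralLinearGroup (Fin n) 𝓀[F]

/-- The inclusion `GL_n(𝒪) → GL_n(F)`. -/
def incl : Matrix.GeneralLinearGroup (Fin n) 𝒪[F] →* GLF F n :=
  Matrix.GeneralLinearGroup.map (algebraMap 𝒪[F] F)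

/-- The reduction map `GL_n(𝒪) → GL_n(k)`. -/
def red : Matrix.GeneralLinearGroup (Fin n) 𝒪[F] →* GLk F n :=
  Matrix.GeneralLinearGroup.map (IsLocalRing.residue 𝒪[F])

/-- `K = GL_n(𝒪)` as a subgroup of `G`. -/
def maxCompact : Subgroup (GLF F n) := (incl F n).range

/-- The pro-`p` radical `K¹ = 1 + ϖ M_n(𝒪)` of `K`: the matrices of `K` that reduce to `1`. -/
def proRadical : Subgroup (GLF F n) := (red F n).ker.map (incl F n)

/-- The subgroup `B_f` of upper triangular matrices of `G_f`. -/
def borel : Subgroup (GLk F n) where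
  carrier := {g | (g : Matrix (Fin n) (Fin n) 𝓀[F]).BlockTriangular id}
  one_mem' := Matrix.blockTriangular_one
  mul_mem' ha hb := Matrix.BlockTriangular.mul ha hb
  inv_mem' {g} hg := by
    have : Invertible (g : Matrix (Fin n) (Fin n) 𝓀[F]) := g.invertible
    have h := Matrix.blockTriangular_inv_of_blockTriangular
      (M := (g : Matrix (Fin n) (Fin n) 𝓀[F])) hg
    rw [← Matrix.coe_units_inv] at h
    exact h

/-- The Iwahori subgroup `I`, the preimage of `B_f` under `K → G_f`. -/
def iwahori : Subgroup (GLF F n) := ((borel F n).comap (red F n)).map (incl F n)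

theorem red_surjective : Function.Surjective (red F n) := by
  intro g
  choose s hs using IsLocalRing.residue_surjective (R := 𝒪[F])
  let M : Matrix (Fin n) (Fin n) 𝒪[F] := (g : Matrix (Fin n) (Fin n) 𝓀[F]).map s
  have hM : M.map (IsLocalRing.residue 𝒪[F]) = g := by
    ext i j; exact hs _
  have hdet : IsUnit M.det := by
    refine isUnit_of_map_unit (IsLocalRing.residue 𝒪[F]) _ ?_
    rw [RingHom.map_det, RingHom.mapMatrix_apply, hM]
    exact (Matrix.isUnit_iff_isUnit_det _).mp g.isUnit
  refine ⟨M.nonsingInvUnit hdet, ?_⟩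
  ext i j
  exact hs _

variable (R : Type*) [Field R]

/-- `H(K)`: the elements of `H(G)` that are supported on `K`. -/
def heckeK : Set (HeckeAlgebra R (GLF F n)) :=
  {f | Function.support f.1 ⊆ maxCompact F n}

/-- The map `H(K) → H(G_f) = R[G_f]`, `f ↦ 1_{K¹} f 1_{K¹}`, where a function on `K` that is
bi-invariant under `K¹` is identified with an element of `R[G_f]` through `1_{gK¹} ↔ g`:
the coefficient at `g ∈ G_f` is the value at any lift of `g` to `K`. -/
def toFinite (f : HeckeAlgebra R (GLF F n)) : MonoidAlgebra R (GLk F n) :=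
  MonoidAlgebra.ofCoeff <| Finsupp.equivFunOnFinite.symm fun g =>
    let e : GLF F n → R := Set.indicator (proRadical F n : Set (GLF F n)) 1
    convolution R (proRadical F n) (convolution R (proRadical F n) e f.1) e
      (incl F n (Function.surjInv (red_surjective F n) g))

/-- The relations `f k ⊗ z = f ⊗ k z` (`k ∈ H(K)`) defining the tensor product over `H(K)`. -/
def balancedRel : Submodule R (HeckeAlgebra R (GLF F n) ⊗[R] MonoidAlgebra R (GLk F n)) :=
  Submodule.span R {t | ∃ (f : HeckeAlgebra R (GLF F n)), ∃ k ∈ heckeK F n R,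
    ∃ z : MonoidAlgebra R (GLk F n),
      t = HeckeAlgebra.mul (proRadical F n) f k ⊗ₜ[R] z - f ⊗ₜ[R] (toFinite F n R k * z)}

/-- `H(G) ⊗_{H(K)} H(G_f)`. -/
abbrev HeckeTensor :=
  (HeckeAlgebra R (GLF F n) ⊗[R] MonoidAlgebra R (GLk F n)) ⧸ balancedRel F n R

/-- The class of `f ⊗ z` in `H(G) ⊗_{H(K)} H(G_f)`. -/
def tmul (f : HeckeAlgebra R (GLF F n)) (z : MonoidAlgebra R (GLk F n)) : HeckeTensor F n R :=
  (balancedRel F n R).mkQ (f ⊗ₜ[R] z)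

/-- For `A ⊆ H(G)` and `B ⊆ H(G_f)`, the subspace `A ⊗_{H(K)} B` of `H(G) ⊗_{H(K)} H(G_f)`
spanned by the `f ⊗ z` with `f ∈ A` and `z ∈ B`. -/
def tensorSpan (A : Set (HeckeAlgebra R (GLF F n))) (B : Set (MonoidAlgebra R (GLk F n))) :
    Submodule R (HeckeTensor F n R) :=
  Submodule.span R {t | ∃ f ∈ A, ∃ z ∈ B, t = tmul F n R f z}

/-- `𝓘`: the annihilator in `H(G)` of `ind_I^G 1`. -/
def annP : Set (HeckeAlgebra R (GLF F n)) :=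
  annihilator R (proRadical F n) (compactInd R (iwahori F n))

/-- `𝓘_f`: the annihilator in `H(G_f) = R[G_f]` of `ind_{B_f}^{G_f} 1`. -/
def annPf : Ideal (MonoidAlgebra R (GLk F n)) :=
  Module.annihilator (MonoidAlgebra R (GLk F n))
    (Representation.ind (borel F n).subtype (Representation.trivial R (borel F n) R)).asModule

end GLn

end Hecke

end

/-! Write `e` for the indicator function of K¹, an idempotent of H(G). An element z of R[G_f]
inflates to a function on K that is bi-invariant under K¹ and maps back to z under H(K) → H(G_f).
The balancing relation therefore gives f ⊗ z = (f * infl z) ⊗ 1 (`tmul_mul_inflation`), and both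
inclusions become statements about functions f * infl z, which are right K¹-invariant.

For z in 𝓘_f it suffices that infl z kills ind_I^G 1. It factors through the projection of a vector
to its K¹-invariants. A K¹-invariant function w, restricted to a coset Kx, becomes a function g ↦
w(gx) on G_f that is right invariant under the image of K ∩ xIx⁻¹. That image contains a conjugate
of B_f (`exists_conj_borel`), so the function lies in a copy of ind_{B_f}^{G_f} 1 and z kills it
(`act_inflation_eq_zero`). The group theory behind this is the decomposition G = K · (monomial
matrices) · I, which reduces x to a monomial matrix. There, an upper triangular matrix for a
suitable ordering of the basis is conjugated into I.

Conversely, let f be in 𝓘. Then f * infl z is again in 𝓘, because it acts as infl z followed by f.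
Being right K¹-invariant, it splits along the cosets xK into translates of inflations of elements
w_x of R[G_f]. Test it on the functions of ind_I^G 1 that are supported on K and inflated from
G_f/B_f: the contributions of different cosets have disjoint supports, so each w_x kills
ind_{B_f}^{G_f} 1 (`exists_eq_sum_of_mem_annP`), and the tensor is a sum of terms 1_{xK¹} ⊗ w_x.

Integration is legitimate because K¹ is a pro-p group and p is invertible in R
(`isNormalizing_proRadical`). -/

noncomputable section

namespace Hecke

/-! ### Haar integration, convolution and the action of the Hecke algebra on smooth vectors -/

section Integration

set_option linter.unusedSectionVars false

variable {R : Type*} [Field R] {G : Type*} [Group G] [TopologicalSpace G] [IsTopologicalGroup G]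
  {V : Type*} [AddCommGroup V] [Module R V] {W : Type*} [AddCommGroup W] [Module R W]

/-- The functions that `haarIntegral` integrates: compactly supported and right invariant under
some open subgroup. -/
structure IsTest (φ : G → V) : Prop where
  compact : HasCompactSupport φ
  smooth : ∃ U : Subgroup G, IsOpen (U : Set G) ∧ ∀ g, ∀ u ∈ U, φ (g * u) = φ g

/-- Local constancy is uniform on the compact support, by the tube lemma, so the stabiliser of f
under right translation contains a neighbourhood of 1 and is open. -/
theorem exists_open_right_invariant {f : G → R} (hf : f ∈ heckeSubmodule R G) :
    ∃ U : Subgroup G, IsOpen (U : Set G) ∧ ∀ g, ∀ u ∈ U, f (g * u) = f g := by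
  let S : Subgroup G :=
    { carrier := {u | ∀ g, f (g * u) = f g}
      one_mem' := fun g => by simp
      mul_mem' := fun {a b} ha hb g => by rw [← mul_assoc, hb, ha]
      inv_mem' := fun {a} ha g => by simpa using (ha (g * a⁻¹)).symm }
  refine ⟨S, S.isOpen_of_mem_nhds (g := 1) ?_, fun g u hu => hu g⟩
  have hop : IsOpen {y : G × G | f (y.1 * y.2) = f y.1} := by
    have hlc : IsLocallyConstant fun y : G × G => (f (y.1 * y.2), f y.1) :=
      (hf.1.comp_continuous (f := fun y : G × G => y.1 * y.2) (by fun_prop)).prodMk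
        (hf.1.comp_continuous (f := fun y : G × G => y.1) (by fun_prop))
    exact hlc {p : R × R | p.1 = p.2}
  obtain ⟨u, v, -, hv, hu, h1v, huv⟩ := generalized_tube_lemma hf.2.isCompact
    (isCompact_singleton (x := (1 : G))) hop (by
      rintro ⟨a, b⟩ ⟨-, hb⟩
      simp only [Set.mem_singleton_iff] at hb
      simp [hb])
  have h1 : (1 : G) ∈ v := h1v rfl
  -- The tube only controls points of the support. If f vanishes at g but not at gx, the estimate is
  -- applied to gx and x⁻¹ instead, hence the symmetric neighbourhood.
  filter_upwards [hv.mem_nhds h1, (hv.preimage continuous_inv).mem_nhds (by simpa using h1)]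
    with x hx hx' g
  by_cases hg : f g = 0
  · by_contra hne
    rw [hg] at hne
    have := huv (show (g * x, x⁻¹) ∈ u ×ˢ v from ⟨hu (subset_tsupport _ hne), hx'⟩)
    simp only [Set.mem_ofPred_eq, mul_inv_cancel_right] at this
    exact hne (by rw [← this, hg])
  · exact huv (show (g, x) ∈ u ×ˢ v from ⟨hu (subset_tsupport _ hg), hx⟩)

theorem exists_open_left_invariant {f : G → R} (hf : f ∈ heckeSubmodule R G) :
    ∃ U : Subgroup G, IsOpen (U : Set G) ∧ ∀ g, ∀ u ∈ U, f (u * g) = f g := by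
  have hf' : (fun g => f g⁻¹) ∈ heckeSubmodule R G :=
    ⟨hf.1.comp_continuous continuous_inv, hf.2.comp_homeomorph (Homeomorph.inv G)⟩
  obtain ⟨U, hU, h⟩ := exists_open_right_invariant hf'
  refine ⟨U, hU, fun g u hu => ?_⟩
  simpa using h g⁻¹ u⁻¹ (U.inv_mem hu)

theorem IsTest.exists_le {φ : G → V} (hφ : IsTest φ) {U₀ : Subgroup G}
    (hU₀ : IsOpen (U₀ : Set G)) :
    ∃ U : Subgroup G, IsOpen (U : Set G) ∧ U ≤ U₀ ∧ ∀ g, ∀ u ∈ U, φ (g * u) = φ g := by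
  obtain ⟨U, hU, h⟩ := hφ.smooth
  refine ⟨U ⊓ U₀, ?_, inf_le_right, fun g u hu => h g u hu.1⟩
  rw [Subgroup.coe_inf]; exact hU.inter hU₀

theorem IsTest.zero : IsTest (0 : G → V) :=
  ⟨HasCompactSupport.zero, ⊤, isOpen_univ, fun _ _ _ => rfl⟩

theorem IsTest.add {φ ψ : G → V} (hφ : IsTest φ) (hψ : IsTest ψ) : IsTest (φ + ψ) := by
  refine ⟨hφ.1.add hψ.1, ?_⟩
  obtain ⟨U, hU, h⟩ := hφ.smooth
  obtain ⟨U', hU', h'⟩ := hψ.smooth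
  refine ⟨U ⊓ U', ?_, fun g u hu => by simp [h g u hu.1, h' g u hu.2]⟩
  rw [Subgroup.coe_inf]; exact hU.inter hU'

theorem IsTest.map {φ : G → V} (hφ : IsTest φ) (L : V →ₗ[R] W) : IsTest fun g => L (φ g) := by
  obtain ⟨U, hU, h⟩ := hφ.smooth
  exact ⟨hφ.1.comp_left (map_zero L), U, hU, fun g u hu => by simp [h g u hu]⟩

theorem IsTest.smul {φ : G → V} (hφ : IsTest φ) (c : R) : IsTest (c • φ) :=
  hφ.map (LinearMap.lsmul R V c)

theorem IsTest.sum {ι : Type*} (s : Finset ι) {φ : ι → G → V} (hφ : ∀ i ∈ s, IsTest (φ i)) :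
    IsTest (∑ i ∈ s, φ i) := by
  classical
  induction s using Finset.induction_on with
  | empty => exact IsTest.zero
  | insert a s ha ih =>
    rw [Finset.sum_insert ha]
    exact (hφ a (by simp)).add (ih fun i hi => hφ i (by simp [hi]))

theorem IsTest.translate {φ : G → V} (hφ : IsTest φ) (g : G) : IsTest fun x => φ (g⁻¹ * x) := by
  obtain ⟨U, hU, h⟩ := hφ.smooth
  exact ⟨hφ.1.comp_homeomorph (Homeomorph.mulLeft g⁻¹), U, hU,
    fun x u hu => by rw [← mul_assoc, h _ u hu]⟩

theorem apply_out {φ : G → V} {U : Subgroup G} (h : ∀ g, ∀ u ∈ U, φ (g * u) = φ g) (g : G) :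
    φ (g : G ⧸ U).out = φ g := by
  obtain ⟨u, hu⟩ := QuotientGroup.mk_out_eq_mul U g
  rw [hu, h g _ u.2]

theorem finite_support_out {φ : G → V} (hφ : HasCompactSupport φ) {U : Subgroup G}
    (hU : IsOpen (U : Set G)) : (Function.support fun x : G ⧸ U => φ x.out).Finite := by
  have : DiscreteTopology (G ⧸ U) := QuotientGroup.discreteTopology hU
  have hc : IsCompact ((fun g : G => (g : G ⧸ U)) '' tsupport φ) :=
    hφ.isCompact.image QuotientGroup.continuous_mk
  exact (isCompact_iff_finite.mp hc).subset fun x hx => ⟨x.out, subset_tsupport _ hx, by simp⟩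

/-- `U₀` is open and the indices of its open subgroups are finite and invertible in `R`, so that it
may be given volume `1` for an `R`-valued Haar measure. -/
structure IsNormalizing (R : Type*) [Field R] {G : Type*} [Group G] [TopologicalSpace G]
    (U₀ : Subgroup G) : Prop where
  isOpen : IsOpen (U₀ : Set G)
  relIndex_ne_zero : ∀ U : Subgroup G, IsOpen (U : Set G) → U ≤ U₀ →
    ((U.relIndex U₀ : ℕ) : R) ≠ 0

variable {U₀ : Subgroup G}

theorem haarIntegral_add (h₀ : IsNormalizing R U₀) {φ ψ : G → V} (hφ : IsTest φ)
    (hψ : IsTest ψ) :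
    haarIntegral R U₀ (φ + ψ) = haarIntegral R U₀ φ + haarIntegral R U₀ ψ := by
  obtain ⟨U, hU, hle, h⟩ := hφ.exists_le h₀.isOpen
  obtain ⟨U', hU', -, h'⟩ := hψ.exists_le h₀.isOpen
  have ho : IsOpen ((U ⊓ U' : Subgroup G) : Set G) := by
    rw [Subgroup.coe_inf]; exact hU.inter hU'
  have e1 : ∀ g, ∀ u ∈ U ⊓ U', φ (g * u) = φ g := fun g u hu => h g u hu.1
  have e2 : ∀ g, ∀ u ∈ U ⊓ U', ψ (g * u) = ψ g := fun g u hu => h' g u hu.2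
  have hl : U ⊓ U' ≤ U₀ := inf_le_left.trans hle
  rw [haarIntegral_eq U₀ h₀.2 φ hφ.1 _ ho hl e1, haarIntegral_eq U₀ h₀.2 ψ hψ.1 _ ho hl e2,
    haarIntegral_eq U₀ h₀.2 (φ + ψ) (hφ.1.add hψ.1) _ ho hl
      (fun g u hu => by simp [e1 g u hu, e2 g u hu]), ← smul_add,
    ← finsum_add_distrib (finite_support_out hφ.1 ho) (finite_support_out hψ.1 ho)]
  rfl

theorem haarIntegral_map (h₀ : IsNormalizing R U₀) {φ : G → V} (hφ : IsTest φ)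
    (L : V →ₗ[R] W) : haarIntegral R U₀ (fun g => L (φ g)) = L (haarIntegral R U₀ φ) := by
  obtain ⟨U, hU, hle, h⟩ := hφ.exists_le h₀.isOpen
  rw [haarIntegral_eq U₀ h₀.2 φ hφ.1 U hU hle h, haarIntegral_eq U₀ h₀.2 _ (hφ.map L).1 U hU hle
    (fun g u hu => by simp [h g u hu]), map_smul]
  congr 1
  exact (L.toAddMonoidHom.map_finsum (finite_support_out hφ.1 hU)).symm

theorem haarIntegral_smul (h₀ : IsNormalizing R U₀) {φ : G → V} (hφ : IsTest φ) (c : R) :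
    haarIntegral R U₀ (c • φ) = c • haarIntegral R U₀ φ :=
  haarIntegral_map h₀ hφ (LinearMap.lsmul R V c)

theorem haarIntegral_zero : haarIntegral R U₀ (0 : G → V) = 0 := by
  rw [haarIntegral]; split_ifs <;> simp

theorem haarIntegral_sum (h₀ : IsNormalizing R U₀) {ι : Type*} (s : Finset ι) {φ : ι → G → V}
    (hφ : ∀ i ∈ s, IsTest (φ i)) :
    haarIntegral R U₀ (∑ i ∈ s, φ i) = ∑ i ∈ s, haarIntegral R U₀ (φ i) := by
  classical
  induction s using Finset.induction_on with
  | empty => simpa using haarIntegral_zero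
  | insert a s ha ih =>
    have hs : ∀ i ∈ s, IsTest (φ i) := fun i hi => hφ i (by simp [hi])
    rw [Finset.sum_insert ha, Finset.sum_insert ha,
      haarIntegral_add h₀ (hφ a (by simp)) (IsTest.sum s hs), ih hs]

/-- Left invariance of the Haar integral. -/
theorem haarIntegral_translate (h₀ : IsNormalizing R U₀) {φ : G → V} (hφ : IsTest φ) (g : G) :
    haarIntegral R U₀ (fun x => φ (g⁻¹ * x)) = haarIntegral R U₀ φ := by
  obtain ⟨U, hU, hle, h⟩ := hφ.exists_le h₀.isOpen
  have h' : ∀ x, ∀ u ∈ U, φ (g⁻¹ * (x * u)) = φ (g⁻¹ * x) :=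
    fun x u hu => by rw [← mul_assoc, h _ u hu]
  rw [haarIntegral_eq U₀ h₀.2 φ hφ.1 U hU hle h,
    haarIntegral_eq U₀ h₀.2 _ (hφ.translate g).1 U hU hle h']
  congr 1
  refine finsum_eq_of_bijective (fun x : G ⧸ U => g⁻¹ • x) (MulAction.bijective g⁻¹) fun x => ?_
  induction x using QuotientGroup.induction_on with
  | H x =>
    rw [apply_out (φ := fun x => φ (g⁻¹ * x)) h' x]
    exact (apply_out h (g⁻¹ * x)).symm

/-- A vector of a representation is smooth if an open subgroup fixes it. -/
def IsSmooth (ρ : Representation R G V) (v : V) : Prop :=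
  ∃ U : Subgroup G, IsOpen (U : Set G) ∧ ∀ u ∈ U, ρ u v = v

variable {ρ : Representation R G V} {v : V}

theorem isTest_act {f : G → R} (hf : f ∈ heckeSubmodule R G) (hv : IsSmooth ρ v) :
    IsTest fun g => f g • ρ g v := by
  obtain ⟨U, hU, h⟩ := exists_open_right_invariant hf
  obtain ⟨U', hU', h'⟩ := hv
  refine ⟨hf.2.smul_right, U ⊓ U', ?_, fun g u hu => ?_⟩
  · rw [Subgroup.coe_inf]; exact hU.inter hU'
  · rw [h g u hu.1, map_mul, Module.End.mul_apply, h' u hu.2]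

theorem act_sum_smul (h₀ : IsNormalizing R U₀) (hv : IsSmooth ρ v) {ι : Type*} (s : Finset ι)
    (c : ι → R) {f : ι → G → R} (hf : ∀ i ∈ s, f i ∈ heckeSubmodule R G) :
    act R U₀ ρ (∑ i ∈ s, c i • f i) v = ∑ i ∈ s, c i • act R U₀ ρ (f i) v := by
  have e : (fun g => (∑ i ∈ s, c i • f i) g • ρ g v) =
      ∑ i ∈ s, c i • fun g => f i g • ρ g v := by
    funext g
    simp [Finset.sum_apply, Finset.sum_smul, smul_smul]
  rw [act, e, haarIntegral_sum h₀ s fun i hi => (isTest_act (hf i hi) hv).smul (c i)]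
  exact Finset.sum_congr rfl fun i hi => haarIntegral_smul h₀ (isTest_act (hf i hi) hv) (c i)

theorem translate_mem {f : G → R} (hf : f ∈ heckeSubmodule R G) (g : G) :
    (fun x => f (g⁻¹ * x)) ∈ heckeSubmodule R G :=
  ⟨hf.1.comp_continuous (continuous_const_mul _), hf.2.comp_homeomorph (Homeomorph.mulLeft g⁻¹)⟩

theorem act_translate (h₀ : IsNormalizing R U₀) (hv : IsSmooth ρ v) {f : G → R}
    (hf : f ∈ heckeSubmodule R G) (g : G) :
    act R U₀ ρ (fun x => f (g⁻¹ * x)) v = ρ g (act R U₀ ρ f v) := by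
  rw [act, act, ← haarIntegral_map h₀ (isTest_act hf hv),
    ← haarIntegral_translate h₀ ((isTest_act hf hv).map (ρ g)) g]
  simp [← Module.End.mul_apply, ← map_mul]

/-- When f is right invariant and h left invariant under the same U, the integrand is constant on
the cosets of U. Convolution by f is thus a finite combination of left translations, which reduces
associativity of the action to `act_translate`. -/
theorem convolution_eq_sum (h₀ : IsNormalizing R U₀) {f h : G → R}
    (hf : f ∈ heckeSubmodule R G) {U : Subgroup G} (hU : IsOpen (U : Set G)) (hle : U ≤ U₀)
    (hfU : ∀ g, ∀ u ∈ U, f (g * u) = f g) (hhU : ∀ g, ∀ u ∈ U, h (u * g) = h g) :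
    convolution R U₀ f h = ∑ y ∈ (finite_support_out hf.2 hU).toFinset,
      (((U.relIndex U₀ : ℕ) : R)⁻¹ * f y.out) • fun x => h (y.out⁻¹ * x) := by
  funext x
  have hc : HasCompactSupport fun g => f g * h (g⁻¹ * x) := hf.2.mul_right
  rw [convolution, haarIntegral_eq U₀ h₀.2 _ hc U hU hle, finsum_eq_sum_of_support_subset
    (s := (finite_support_out hf.2 hU).toFinset)]
  · simp [Finset.sum_apply, Finset.mul_sum, mul_assoc]
  · intro y hy
    simpa using left_ne_zero_of_mul hy
  · intro g u hu
    rw [hfU g u hu, mul_inv_rev, mul_assoc, hhU _ _ (U.inv_mem hu)]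

theorem act_eq_sum (h₀ : IsNormalizing R U₀) {f : G → R}
    (hf : f ∈ heckeSubmodule R G) {U : Subgroup G} (hU : IsOpen (U : Set G)) (hle : U ≤ U₀)
    (hfU : ∀ g, ∀ u ∈ U, f (g * u) = f g) (hvU : ∀ u ∈ U, ρ u v = v) :
    act R U₀ ρ f v = ∑ y ∈ (finite_support_out hf.2 hU).toFinset,
      (((U.relIndex U₀ : ℕ) : R)⁻¹ * f y.out) • ρ y.out v := by
  have hc : HasCompactSupport fun g => f g • ρ g v := hf.2.smul_right
  rw [act, haarIntegral_eq U₀ h₀.2 _ hc U hU hle, finsum_eq_sum_of_support_subset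
    (s := (finite_support_out hf.2 hU).toFinset)]
  · simp [Finset.smul_sum, smul_smul]
  · intro y hy
    have := left_ne_zero_of_smul hy
    simpa using this
  · intro g u hu
    rw [hfU g u hu, map_mul, Module.End.mul_apply, hvU u hu]

theorem isSmooth_act (h₀ : IsNormalizing R U₀) (hv : IsSmooth ρ v) {f : G → R}
    (hf : f ∈ heckeSubmodule R G) : IsSmooth ρ (act R U₀ ρ f v) := by
  obtain ⟨U, hU, h⟩ := exists_open_left_invariant hf
  refine ⟨U, hU, fun u hu => ?_⟩
  rw [← act_translate h₀ hv hf]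
  simp [h _ _ (U.inv_mem hu)]

theorem act_convolution (h₀ : IsNormalizing R U₀) (hv : IsSmooth ρ v) {f h : G → R}
    (hf : f ∈ heckeSubmodule R G) (hh : h ∈ heckeSubmodule R G) :
    act R U₀ ρ (convolution R U₀ f h) v = act R U₀ ρ f (act R U₀ ρ h v) := by
  obtain ⟨U₁, ho₁, h₁⟩ := exists_open_right_invariant hf
  obtain ⟨U₂, ho₂, h₂⟩ := exists_open_left_invariant hh
  obtain ⟨U₃, ho₃, h₃⟩ := isSmooth_act h₀ hv hh
  -- One subgroup fine enough for f, for h and for the vector h v, so that both sides are sums over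
  -- the same cosets.
  have ho : IsOpen ((U₁ ⊓ U₂ ⊓ U₃ ⊓ U₀ : Subgroup G) : Set G) := by
    simp only [Subgroup.coe_inf]; exact ((ho₁.inter ho₂).inter ho₃).inter h₀.1
  have f₁ : ∀ g, ∀ u ∈ U₁ ⊓ U₂ ⊓ U₃ ⊓ U₀, f (g * u) = f g := fun g u hu => h₁ g u hu.1.1.1
  rw [convolution_eq_sum h₀ hf ho inf_le_right f₁ fun g u hu => h₂ g u hu.1.1.2,
    act_sum_smul h₀ hv _ _ fun y _ => translate_mem hh y.out,
    act_eq_sum h₀ hf ho inf_le_right f₁ fun u hu => h₃ u hu.1.2]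
  exact Finset.sum_congr rfl fun y _ => by rw [act_translate h₀ hv hh]

theorem isSmooth_compactInd (H : Subgroup G) (v : CompactInd R H) :
    IsSmooth (compactInd R H) v := by
  obtain ⟨φ, h1, ⟨V, hV, hV'⟩, hC⟩ := v
  refine ⟨V, hV, fun u hu => Subtype.ext (funext fun x => ?_)⟩
  exact hV' _ (V.inv_mem hu) x

theorem haarIntegral_of_support_subset_coset (h₀ : IsNormalizing R U₀)
    (hc : IsCompact (U₀ : Set G)) {φ : G → V} (x : G) (hφ : ∀ g, ∀ u ∈ U₀, φ (g * u) = φ g)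
    (hx : ∀ g, x⁻¹ * g ∉ U₀ → φ g = 0) : haarIntegral R U₀ φ = φ x := by
  have hcs : HasCompactSupport φ := HasCompactSupport.intro (hc.smul x) fun g hg =>
    hx g fun h => hg ⟨x⁻¹ * g, h, by simp⟩
  rw [haarIntegral_eq U₀ h₀.2 φ hcs U₀ h₀.1 le_rfl hφ, Subgroup.relIndex_self, Nat.cast_one,
    inv_one, one_smul, finsum_eq_single _ (x : G ⧸ U₀), apply_out hφ]
  intro q hq
  refine hx _ fun h => hq ?_
  rw [← q.out_eq']
  exact (QuotientGroup.eq.mpr h).symm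

/-- The convolution with the indicator function of `x U₀` is the translation by `x`. -/
theorem convolution_indicator_left (h₀ : IsNormalizing R U₀) (hc : IsCompact (U₀ : Set G))
    {h : G → R} (hh : ∀ g, ∀ u ∈ U₀, h (u * g) = h g) (x : G) :
    convolution R U₀ (fun g => Set.indicator (U₀ : Set G) 1 (x⁻¹ * g)) h =
      fun y => h (x⁻¹ * y) := by
  classical
  funext y
  rw [convolution, haarIntegral_of_support_subset_coset h₀ hc x]
  · simp [U₀.one_mem]
  · intro g u hu
    rw [mul_inv_rev, mul_assoc, hh _ _ (U₀.inv_mem hu), ← mul_assoc]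
    congr 1
    simp only [Set.indicator_apply, SetLike.mem_coe, Pi.one_apply, U₀.mul_mem_cancel_right hu]
  · intro g hg
    simp [hg]

theorem convolution_indicator_right (h₀ : IsNormalizing R U₀) (hc : IsCompact (U₀ : Set G))
    {f : G → R} (hf : ∀ g, ∀ u ∈ U₀, f (g * u) = f g) :
    convolution R U₀ f (Set.indicator (U₀ : Set G) 1) = f := by
  classical
  funext y
  rw [convolution, haarIntegral_of_support_subset_coset h₀ hc y]
  · simp [U₀.one_mem]
  · intro g u hu
    rw [hf g u hu, mul_inv_rev, mul_assoc]
    congr 1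
    simp only [Set.indicator_apply, SetLike.mem_coe, Pi.one_apply, U₀.mul_mem_cancel_left (U₀.inv_mem hu)]
  · intro g hg
    have : g⁻¹ * y ∉ U₀ := fun h => hg (by simpa using U₀.inv_mem h)
    simp [this]

theorem indicator_mem (ho : IsOpen (U₀ : Set G)) (hc : IsCompact (U₀ : Set G)) :
    Set.indicator (U₀ : Set G) (1 : G → R) ∈ heckeSubmodule R G := by
  have hcl : IsClopen (U₀ : Set G) := ⟨U₀.isClosed_of_isOpen ho, ho⟩
  exact ⟨(LocallyConstant.charFn R hcl).isLocallyConstant,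
    HasCompactSupport.intro hc fun x hx => Set.indicator_of_notMem hx _⟩

/-- A vector fixed by `U₀` is fixed by the indicator function of `U₀`. -/
theorem act_indicator_of_fixed (h₀ : IsNormalizing R U₀) (hc : IsCompact (U₀ : Set G))
    (hv : ∀ u ∈ U₀, ρ u v = v) : act R U₀ ρ (Set.indicator (U₀ : Set G) 1) v = v := by
  classical
  rw [act, haarIntegral_of_support_subset_coset h₀ hc 1]
  · simp [U₀.one_mem]
  · intro g u hu
    rw [map_mul, Module.End.mul_apply, hv u hu]
    congr 1
    simp only [Set.indicator_apply, SetLike.mem_coe, Pi.one_apply, U₀.mul_mem_cancel_right hu]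
  · intro g hg
    have : g ∉ U₀ := by simpa using hg
    simp [this]

/-- The indicator function of `U₀` maps smooth vectors to vectors fixed by `U₀`. -/
theorem apply_act_indicator (h₀ : IsNormalizing R U₀) (hc : IsCompact (U₀ : Set G))
    (hv : IsSmooth ρ v) {u : G} (hu : u ∈ U₀) :
    ρ u (act R U₀ ρ (Set.indicator (U₀ : Set G) 1) v) =
      act R U₀ ρ (Set.indicator (U₀ : Set G) 1) v := by
  classical
  rw [← act_translate h₀ hv (indicator_mem h₀.1 hc)]
  congr 1
  funext x
  simp only [Set.indicator_apply, SetLike.mem_coe, Pi.one_apply, U₀.mul_mem_cancel_left (U₀.inv_mem hu)]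

end Integration

/-! ### K is compact, K¹ is compact, open and pro-p -/

section Topology

set_option linter.unusedSectionVars false

variable (F : Type*) [Field F] [ValuativeRel F] [TopologicalSpace F] [IsNonarchimedeanLocalField F]
  (n : ℕ)

theorem incl_injective : Function.Injective (incl F n) := by
  intro a b h
  ext i j
  have := congrArg (fun g : GLF F n => (g : Matrix (Fin n) (Fin n) F) i j) h
  exact this

@[simp]
theorem incl_apply (g : Matrix.GeneralLinearGroup (Fin n) 𝒪[F]) (i j : Fin n) :
    (incl F n g : Matrix (Fin n) (Fin n) F) i j = ((g i j : 𝒪[F]) : F) := rfl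

@[simp]
theorem red_apply (g : Matrix.GeneralLinearGroup (Fin n) 𝒪[F]) (i j : Fin n) :
    (red F n g : Matrix (Fin n) (Fin n) 𝓀[F]) i j = IsLocalRing.residue 𝒪[F] (g i j) := rfl

theorem continuous_incl : Continuous (incl F n) := by
  refine Continuous.units_map _ ?_
  refine continuous_matrix fun i j => ?_
  exact continuous_subtype_val.comp (continuous_apply_apply i j)

theorem isCompact_maxCompact : IsCompact (maxCompact F n : Set (GLF F n)) := by
  have : T2Space F := by
    let := IsTopologicalAddGroup.rightUniformSpace F
    have := isUniformAddGroup_of_addCommGroup (G := F)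
    infer_instance
  have : CompactSpace (Matrix (Fin n) (Fin n) 𝒪[F]) :=
    inferInstanceAs (CompactSpace (Fin n → Fin n → 𝒪[F]))
  have : CompactSpace (Matrix.GeneralLinearGroup (Fin n) 𝒪[F]) :=
    inferInstanceAs (CompactSpace (Matrix (Fin n) (Fin n) 𝒪[F])ˣ)
  rw [maxCompact, MonoidHom.coe_range]
  exact isCompact_range (continuous_incl F n)

theorem exists_incl_eq {g : GLF F n}
    (h : ∀ i j, (g : Matrix (Fin n) (Fin n) F) i j ∈ 𝒪[F])
    (h' : ∀ i j, ((g⁻¹ : GLF F n) : Matrix (Fin n) (Fin n) F) i j ∈ 𝒪[F]) :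
    ∃ k : Matrix.GeneralLinearGroup (Fin n) 𝒪[F], incl F n k = g := by
  let A : Matrix (Fin n) (Fin n) 𝒪[F] := fun i j => ⟨_, h i j⟩
  let B : Matrix (Fin n) (Fin n) 𝒪[F] := fun i j => ⟨_, h' i j⟩
  have hinj : Function.Injective
      ((algebraMap 𝒪[F] F).mapMatrix : Matrix (Fin n) (Fin n) 𝒪[F] →+* _) := by
    intro a b hab
    ext i j
    exact congrFun (congrFun hab i) j
  have hA : (algebraMap 𝒪[F] F).mapMatrix A = g := rfl
  have hB : (algebraMap 𝒪[F] F).mapMatrix B = (g⁻¹ : GLF F n) := rfl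
  refine ⟨⟨A, B, hinj ?_, hinj ?_⟩, ?_⟩
  · rw [map_mul, hA, hB, map_one, ← Units.val_mul, mul_inv_cancel, Units.val_one]
  · rw [map_mul, hA, hB, map_one, ← Units.val_mul, inv_mul_cancel, Units.val_one]
  · ext i j; rfl

theorem incl_mem_proRadical {k : Matrix.GeneralLinearGroup (Fin n) 𝒪[F]} :
    incl F n k ∈ proRadical F n ↔ red F n k = 1 := by
  rw [proRadical, Subgroup.mem_map_iff_mem (incl_injective F n), MonoidHom.mem_ker]

theorem residue_eq_zero_iff (x : 𝒪[F]) :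
    IsLocalRing.residue 𝒪[F] x = 0 ↔ ValuativeRel.valuation F (x : F) < 1 := by
  rw [IsLocalRing.residue_eq_zero_iff]
  exact Valuation.mem_maximalIdeal_iff (v := ValuativeRel.valuation F) (a := x)

theorem red_eq_one_iff {k : Matrix.GeneralLinearGroup (Fin n) 𝒪[F]} :
    red F n k = 1 ↔ ∀ i j, k i j - (1 : Matrix (Fin n) (Fin n) 𝒪[F]) i j ∈ 𝓂[F] := by
  simp_rw [← IsLocalRing.residue_eq_zero_iff, map_sub, sub_eq_zero]
  rw [Units.ext_iff, ← Matrix.ext_iff]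
  refine forall₂_congr fun i j => ?_
  rw [red_apply, Units.val_one, Matrix.one_apply, Matrix.one_apply]
  split_ifs <;> simp

theorem isOpen_proRadical : IsOpen (proRadical F n : Set (GLF F n)) := by
  have hO : IsOpen (𝒪[F] : Set F) := Valuation.isOpen_integer
  have hm : IsOpen {x : F | ValuativeRel.valuation F x < 1} := by
    have := Valuation.isOpen_ball (v := ValuativeRel.valuation F) 1
    simpa only [Valuation.restrict_lt_one_iff] using this
  -- Membership in K¹ is a finite set of open conditions on entries. Those on g⁻¹ ensure that g is
  -- invertible over the integers.
  have key : (proRadical F n : Set (GLF F n)) =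
      (⋂ i, ⋂ j, {g : GLF F n | (g : Matrix (Fin n) (Fin n) F) i j ∈ (𝒪[F] : Set F)}) ∩
      (⋂ i, ⋂ j, {g : GLF F n | ((g⁻¹ : GLF F n) : Matrix (Fin n) (Fin n) F) i j ∈ (𝒪[F] : Set F)}) ∩
      ⋂ i, ⋂ j, {g : GLF F n | (g : Matrix (Fin n) (Fin n) F) i j - (1 : Matrix (Fin n) (Fin n) F) i j ∈
        {x : F | ValuativeRel.valuation F x < 1}} := by
    ext g
    simp only [Set.mem_inter_iff, Set.mem_iInter, Set.mem_ofPred_eq, SetLike.mem_coe]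
    constructor
    · rintro ⟨k, hk, rfl⟩
      rw [SetLike.mem_coe, MonoidHom.mem_ker, red_eq_one_iff] at hk
      refine ⟨⟨fun i j => (k i j).2, fun i j => ?_⟩, fun i j => ?_⟩
      · rw [← map_inv]
        exact ((k⁻¹ : Matrix.GeneralLinearGroup (Fin n) 𝒪[F]) i j).2
      · have := hk i j
        rw [← IsLocalRing.residue_eq_zero_iff, residue_eq_zero_iff] at this
        simpa [Matrix.one_apply, apply_ite] using this
    · rintro ⟨⟨h, h'⟩, h1⟩
      obtain ⟨k, rfl⟩ := exists_incl_eq F n h h'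
      rw [incl_mem_proRadical, red_eq_one_iff]
      intro i j
      rw [← IsLocalRing.residue_eq_zero_iff, residue_eq_zero_iff]
      simpa [Matrix.one_apply, apply_ite] using h1 i j
  rw [key]
  have hc : ∀ i j, Continuous fun g : GLF F n => (g : Matrix (Fin n) (Fin n) F) i j :=
    fun i j => Units.continuous_val.matrix_elem i j
  refine ((isOpen_iInter_of_finite fun i => isOpen_iInter_of_finite fun j => ?_).inter
    (isOpen_iInter_of_finite fun i => isOpen_iInter_of_finite fun j => ?_)).inter
    (isOpen_iInter_of_finite fun i => isOpen_iInter_of_finite fun j => ?_)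
  · exact hO.preimage (hc i j)
  · exact hO.preimage ((hc i j).comp continuous_inv)
  · exact hm.preimage ((hc i j).sub continuous_const)

theorem proRadical_le : proRadical F n ≤ maxCompact F n := by
  rintro _ ⟨k, -, rfl⟩
  exact ⟨k, rfl⟩

theorem isCompact_proRadical : IsCompact (proRadical F n : Set (GLF F n)) :=
  (isCompact_maxCompact F n).of_isClosed_subset
    ((proRadical F n).isClosed_of_isOpen (isOpen_proRadical F n)) (proRadical_le F n)

theorem isOpen_maxCompact : IsOpen (maxCompact F n : Set (GLF F n)) :=
  Subgroup.isOpen_mono (proRadical_le F n) (isOpen_proRadical F n)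

/-- In a compact group all of whose elements are topologically of `p`-power order, the index of an
open subgroup is a power of `p`. -/
theorem index_eq_prime_pow {G : Type*} [Group G] [TopologicalSpace G] [IsTopologicalGroup G]
    [CompactSpace G] {p : ℕ} [Fact p.Prime]
    (hG : ∀ W : Set G, IsOpen W → 1 ∈ W → ∀ g : G, ∃ m : ℕ, g ^ p ^ m ∈ W)
    (U : Subgroup G) (hU : IsOpen (U : Set G)) : ∃ k, U.index = p ^ k := by
  have : Finite (G ⧸ U) := U.quotient_finite_of_isOpen hU
  have : U.FiniteIndex := U.finiteIndex_of_finite_quotient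
  -- The normal core is an intersection of closed conjugates of finite index, hence open, so the
  -- hypothesis on powers makes the quotient by it a finite p-group.
  have hcl : IsClosed (U.normalCore : Set G) := by
    have : (U.normalCore : Set G) = ⋂ b : G, (fun a => b * a * b⁻¹) ⁻¹' (U : Set G) := by
      ext a; simp [Subgroup.normalCore]
    rw [this]
    exact isClosed_iInter fun b => (U.isClosed_of_isOpen hU).preimage (by fun_prop)
  have ho := U.normalCore.isOpen_of_isClosed_of_finiteIndex hcl
  have hp : IsPGroup p (G ⧸ U.normalCore) := by
    intro g
    induction g using QuotientGroup.induction_on with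
    | H g =>
      obtain ⟨m, hm⟩ := hG _ ho U.normalCore.one_mem g
      exact ⟨m, by rw [← QuotientGroup.mk_pow]; exact (QuotientGroup.eq_one_iff _).mpr hm⟩
  obtain ⟨k, hk⟩ := hp.exists_card_eq
  obtain ⟨m, -, hm⟩ := (Nat.dvd_prime_pow Fact.out).mp
    (hk ▸ Subgroup.index_dvd_of_le U.normalCore_le : U.index ∣ p ^ k)
  exact ⟨m, hm⟩

/-- The binomial expansion modulo x², over a ring that need not be commutative, for use with
matrices. -/
theorem exists_one_add_pow_eq {A : Type*} [Ring A] (x : A) (p : ℕ) :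
    ∃ y, (1 + x) ^ p = 1 + p * x + x * x * y := by
  induction p with
  | zero => exact ⟨0, by simp⟩
  | succ p ih =>
    obtain ⟨y, hy⟩ := ih
    refine ⟨y + y * x + p, ?_⟩
    have hc : x * (p : A) = p * x := (Nat.cast_commute p x).symm.eq
    rw [pow_succ, hy, Nat.cast_succ]
    simp only [mul_add, add_mul, mul_one, one_mul, mul_assoc, hc]
    rw [← mul_assoc x (p : A) x, hc, mul_assoc]
    abel

theorem mul_apply_mem {A : Type*} [CommRing A] {ι : Type*} [Fintype ι] {I J : Ideal A}
    {X Y : Matrix ι ι A} (hX : ∀ i j, X i j ∈ I) (hY : ∀ i j, Y i j ∈ J) (i j : ι) :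
    (X * Y) i j ∈ I * J :=
  Ideal.sum_mem _ fun k _ => Ideal.mul_mem_mul (hX i k) (hY k j)

/-- If Y = X^(p^m) − 1, then (1 + Y)^p − 1 = pY + Y²Z. The first term gains a factor in I from p,
the second from squaring Y. -/
theorem pow_prime_pow_sub_one_mem {A : Type*} [CommRing A] {ι : Type*} [Fintype ι] [DecidableEq ι]
    {I : Ideal A} {p : ℕ} (hp : (p : A) ∈ I) {X : Matrix ι ι A}
    (hX : ∀ i j, (X - 1) i j ∈ I) (m : ℕ) (i j : ι) : (X ^ p ^ m - 1) i j ∈ I ^ (m + 1) := by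
  induction m generalizing i j with
  | zero => simpa using hX i j
  | succ m ih =>
    set Y := X ^ p ^ m - 1 with hY
    obtain ⟨Z, hZ⟩ := exists_one_add_pow_eq Y p
    have e : X ^ p ^ (m + 1) - 1 = p * Y + Y * Y * Z := by
      rw [pow_succ, pow_mul, ← add_sub_cancel 1 (X ^ p ^ m), ← hY, hZ]
      abel
    rw [e, Matrix.add_apply]
    refine Ideal.add_mem _ ?_ ?_
    · rw [← nsmul_eq_mul, Matrix.smul_apply, nsmul_eq_mul, pow_succ']
      exact Ideal.mul_mem_mul hp (ih i j)
    · have h2 : ∀ i j, (Y * Y) i j ∈ I ^ (m + 1 + 1) := fun i j => by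
        rw [pow_succ]
        exact Ideal.mul_mono_right (Ideal.pow_le_self m.succ_ne_zero) (mul_apply_mem ih ih i j)
      have := mul_apply_mem (J := ⊤) h2 (Y := Z) (fun _ _ => trivial) i j
      simpa using this

theorem tendsto_zero_of_mem_pow {a : ℕ → 𝒪[F]} (ha : ∀ m, a m ∈ 𝓂[F] ^ m) :
    Filter.Tendsto (fun m => (a m : F)) Filter.atTop (nhds 0) := by
  obtain ⟨ϖ, hϖ⟩ := IsDiscreteValuationRing.exists_irreducible 𝒪[F]
  have hlt : ValuativeRel.valuation F (ϖ : F) < 1 := by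
    rw [← residue_eq_zero_iff, IsLocalRing.residue_eq_zero_iff]
    exact hϖ.not_isUnit
  -- The valuation has rank at most one, so the powers of a uniformiser fall below every γ.
  have : MulArchimedean (ValuativeRel.ValueGroupWithZero F) :=
    ValuativeRel.isRankLeOne_iff_mulArchimedean.mp inferInstance
  rw [(IsValuativeTopology.hasBasis_nhds_zero F).tendsto_right_iff]
  intro γ _
  obtain ⟨N, hN⟩ := exists_pow_lt₀ hlt γ
  filter_upwards [Filter.eventually_ge_atTop N] with m hm
  have h := Ideal.pow_le_pow_right hm (ha m)
  rw [hϖ.maximalIdeal_eq, Ideal.span_singleton_pow, Ideal.mem_span_singleton] at h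
  obtain ⟨b, hb⟩ := h
  show ValuativeRel.valuation F (a m : F) < γ
  rw [hb]
  push_cast
  rw [map_mul, map_pow]
  exact (mul_le_of_le_one_right' b.2).trans_lt hN

theorem exists_pow_mem_of_mem_proRadical {p : ℕ} [CharP 𝓀[F] p] {g : GLF F n}
    (hg : g ∈ proRadical F n) {W : Set (GLF F n)} (hW : IsOpen W) (h1 : 1 ∈ W) :
    ∃ m : ℕ, g ^ p ^ m ∈ W := by
  have hp : (p : 𝒪[F]) ∈ 𝓂[F] := by
    rw [← IsLocalRing.residue_eq_zero_iff, map_natCast, CharP.cast_eq_zero]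
  have key : ∀ g ∈ proRadical F n, Filter.Tendsto
      (fun m : ℕ => ((g ^ p ^ m : GLF F n) : Matrix (Fin n) (Fin n) F)) Filter.atTop (nhds 1) := by
    rintro _ ⟨k, hk, rfl⟩
    rw [SetLike.mem_coe, MonoidHom.mem_ker, red_eq_one_iff] at hk
    refine tendsto_pi_nhds.mpr fun i => tendsto_pi_nhds.mpr fun j => ?_
    have h := tendsto_zero_of_mem_pow F (a := fun m =>
        ((k : Matrix (Fin n) (Fin n) 𝒪[F]) ^ p ^ m - 1) i j) fun m =>
      Ideal.pow_le_pow_right m.le_succ (pow_prime_pow_sub_one_mem hp hk m i j)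
    have h' := h.add_const ((1 : Matrix (Fin n) (Fin n) F) i j)
    rw [zero_add] at h'
    refine h'.congr fun m => ?_
    rw [← map_pow, incl_apply, Matrix.sub_apply]
    have : (((1 : Matrix (Fin n) (Fin n) 𝒪[F]) i j : 𝒪[F]) : F) =
        (1 : Matrix (Fin n) (Fin n) F) i j := by
      rw [Matrix.one_apply, Matrix.one_apply]; split_ifs <;> simp
    push_cast
    rw [this, sub_add_cancel]
  have ht : Filter.Tendsto (fun m : ℕ => g ^ p ^ m) Filter.atTop (nhds 1) := by
    -- The topology of the unit group also requires the inverses to converge; they do because g⁻¹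
    -- lies in K¹ too.
    rw [Units.isEmbedding_embedProduct.tendsto_nhds_iff]
    refine (key g hg).prodMk_nhds ?_
    refine (MulOpposite.continuous_op.tendsto _).comp ?_
    have := key g⁻¹ (inv_mem hg)
    simpa only [inv_pow, Function.comp_def, inv_one, Units.val_one] using this
  exact (ht.eventually (hW.mem_nhds h1)).exists

theorem isNormalizing_proRadical (R : Type*) [Field R] {p l : ℕ} [CharP 𝓀[F] p] [CharP R l]
    (hlp : l ≠ p) : IsNormalizing R (proRadical F n) := by
  have hp : Fact p.Prime := ⟨(CharP.char_is_prime_or_zero 𝓀[F] p).resolve_right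
    (CharP.char_ne_zero_of_finite 𝓀[F] p)⟩
  refine ⟨isOpen_proRadical F n, fun U hU hle => ?_⟩
  have : CompactSpace (proRadical F n) := isCompact_iff_compactSpace.mp (isCompact_proRadical F n)
  obtain ⟨k, hk⟩ := index_eq_prime_pow (G := proRadical F n) (p := p) (fun W hW h1 g => by
    obtain ⟨W', hW', rfl⟩ := isOpen_induced_iff.mp hW
    obtain ⟨m, hm⟩ := exists_pow_mem_of_mem_proRadical F n (p := p) g.2 hW' h1
    exact ⟨m, hm⟩) (U.subgroupOf (proRadical F n)) (hU.preimage continuous_subtype_val)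
  rw [Subgroup.relIndex, hk, Nat.cast_pow]
  refine pow_ne_zero _ fun h0 => ?_
  rw [CharP.cast_eq_zero_iff R l] at h0
  rcases (Nat.dvd_prime hp.out).mp h0 with h | h
  · exact CharP.char_ne_one R l h
  · exact hlp h

end Topology

/-! ### Gaussian elimination by K and I, and the Borel subgroup inside K ∩ xIx⁻¹ -/

section Elimination

/-- The unipotent matrix `1 - u vᵀ`, where `v ⬝ u = 0`. -/
def unipotent {A : Type*} [CommRing A] {ι : Type*} [Fintype ι] [DecidableEq ι] (u v : ι → A)
    (h : v ⬝ᵥ u = 0) : Matrix.GeneralLinearGroup ι A where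
  val := 1 - Matrix.vecMulVec u v
  inv := 1 + Matrix.vecMulVec u v
  val_inv := by
    have : Matrix.vecMulVec u v * Matrix.vecMulVec u v = 0 := by
      rw [Matrix.vecMulVec_mul_vecMulVec, h]; simp
    simp [sub_mul, mul_add, this]
  inv_val := by
    have : Matrix.vecMulVec u v * Matrix.vecMulVec u v = 0 := by
      rw [Matrix.vecMulVec_mul_vecMulVec, h]; simp
    simp [add_mul, mul_sub, this]

/-- The only nonzero entry of `X` in row `i` and in column `j` is at `(i, j)`. -/
def IsPivot {A : Type*} [Zero A] {ι : Type*} (X : Matrix ι ι A) (i j : ι) : Prop :=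
  X i j ≠ 0 ∧ (∀ i', i' ≠ i → X i' j = 0) ∧ ∀ j', j' ≠ j → X i j' = 0

variable {F : Type*} [Field F] [ValuativeRel F] [TopologicalSpace F] [IsNonarchimedeanLocalField F]
  {n : ℕ}

theorem incl_mem_iwahori {k : Matrix.GeneralLinearGroup (Fin n) 𝒪[F]}
    (hk : ∀ i j, j < i → ValuativeRel.valuation F (k i j : F) < 1) :
    incl F n k ∈ iwahori F n := by
  refine ⟨k, fun i j hij => ?_, rfl⟩
  rw [red_apply, residue_eq_zero_iff]
  exact hk i j hij

/-- One elimination step. Among the columns without a pivot, an entry of maximal valuation is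
chosen, so all quotients needed to clear its row and column are integral. Row operations may be any
in K, but column operations must lie in I, which dictates how ties are broken. -/
theorem exists_isPivot_step (x : GLF F n) (hx : ∃ j, ∀ i, ¬ IsPivot x.1 i j) :
    ∃ k ∈ maxCompact F n, ∃ u ∈ iwahori F n,
      (∀ i j, IsPivot x.1 i j → IsPivot (k * x * u).1 i j) ∧
      ∃ j, (∀ i, ¬ IsPivot x.1 i j) ∧ ∃ i, IsPivot (k * x * u).1 i j := by
  classical
  obtain ⟨j₀, hj₀⟩ := hx
  let S : Finset (Fin n × Fin n) :=
    Finset.univ.filter fun q => x.1 q.1 q.2 ≠ 0 ∧ ∀ i, ¬ IsPivot x.1 i q.2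
  have hS : S.Nonempty := by
    by_contra hne
    have h0 : ∀ i, x.1 i j₀ = 0 := by
      intro i
      by_contra hi
      exact hne ⟨(i, j₀), by simp [S, hi, hj₀]⟩
    have hdet := x.1.det_eq_zero_of_column_eq_zero j₀ h0
    exact ((Matrix.isUnit_iff_isUnit_det _).mp x.isUnit).ne_zero hdet
  -- Ties in the valuation go to the leftmost column. Entries of row i to the left of the pivot are
  -- then strictly smaller, and these give the below-diagonal entries of the column operation.
  obtain ⟨⟨i, j⟩, hij, hmax⟩ := S.exists_max_image
    (fun q => toLex (ValuativeRel.valuation F (x.1 q.1 q.2), OrderDual.toDual q.2)) hS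
  obtain ⟨hne, hj⟩ : x.1 i j ≠ 0 ∧ ∀ i, ¬ IsPivot x.1 i j := by simpa [S] using hij
  have hv0 : ValuativeRel.valuation F (x.1 i j) ≠ 0 := by simpa using hne
  -- Rows and columns of earlier pivots vanish where the new operations act, so those pivots
  -- survive.
  have hrow : ∀ i' j', IsPivot x.1 i' j' → x.1 i j' = 0 ∧ x.1 i' j = 0 := by
    intro i' j' hp
    have hjj : j ≠ j' := by rintro rfl; exact hj _ hp
    have hii : i ≠ i' := by rintro rfl; exact hne (hp.2.2 j hjj)
    exact ⟨hp.2.1 i hii, hp.2.2 j hjj⟩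
  have hcol_le : ∀ a, ValuativeRel.valuation F (x.1 a j / x.1 i j) ≤ 1 := by
    intro a
    by_cases ha : x.1 a j = 0
    · simp [ha]
    · have := hmax (a, j) (by simp [S, ha, hj])
      rw [Prod.Lex.toLex_le_toLex] at this
      rw [map_div₀]
      refine div_le_one_of_le₀ ?_ zero_le
      rcases this with h | h
      · exact h.le
      · exact h.1.le
  have hrow_lt : ∀ b, ValuativeRel.valuation F (x.1 i b / x.1 i j) ≤ 1 ∧
      (b < j → ValuativeRel.valuation F (x.1 i b / x.1 i j) < 1) := by
    intro b
    by_cases hb : x.1 i b = 0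
    · simp [hb]
    · have := hmax (i, b) (by
        simp only [S, Finset.mem_filter, Finset.mem_univ, true_and]
        exact ⟨hb, fun i' hp => hb (hrow i' b hp).1⟩)
      rw [Prod.Lex.toLex_le_toLex] at this
      rw [map_div₀]
      rcases this with h | h
      · have := (div_lt_one₀ (zero_lt_iff.mpr hv0)).mpr h
        exact ⟨this.le, fun _ => this⟩
      · refine ⟨div_le_one_of_le₀ h.1.le zero_le, fun hbj => ?_⟩
        exact absurd (OrderDual.toDual_le_toDual.mp h.2) (not_le.mpr hbj)
  let c : Fin n → 𝒪[F] := fun a => if a = i then 0 else ⟨x.1 a j / x.1 i j, hcol_le a⟩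
  let r : Fin n → 𝒪[F] := fun b => if b = j then 0 else ⟨x.1 i b / x.1 i j, (hrow_lt b).1⟩
  let k := unipotent c (Pi.single i 1) (by simp [c])
  let u := unipotent (Pi.single j 1) r (by simp [r])
  have hci : c i = 0 := by simp [c]
  have hrj : r j = 0 := by simp [r]
  have hca : ∀ a, a ≠ i → (c a : F) = x.1 a j / x.1 i j := fun a ha => by simp [c, ha]
  have hrb : ∀ b, b ≠ j → (r b : F) = x.1 i b / x.1 i j := fun b hb => by simp [r, hb]
  have hk : ∀ a b, (incl F n k).1 a b =
      (1 : Matrix (Fin n) (Fin n) F) a b - c a * (Pi.single i 1 : Fin n → F) b := by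
    intro a b
    change (((1 : Matrix (Fin n) (Fin n) 𝒪[F]) a b -
      c a * (Pi.single i 1 : Fin n → 𝒪[F]) b : 𝒪[F]) : F) = _
    simp only [Matrix.one_apply, Pi.single_apply]
    split_ifs <;> simp
  have hu : ∀ a b, (incl F n u).1 a b =
      (1 : Matrix (Fin n) (Fin n) F) a b - (Pi.single j 1 : Fin n → F) a * r b := by
    intro a b
    change (((1 : Matrix (Fin n) (Fin n) 𝒪[F]) a b -
      (Pi.single j 1 : Fin n → 𝒪[F]) a * r b : 𝒪[F]) : F) = _
    simp only [Matrix.one_apply, Pi.single_apply]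
    split_ifs <;> simp
  have hY : ∀ a b, (incl F n k * x * incl F n u).1 a b =
      x.1 a b - c a * x.1 i b - (x.1 a j - c a * x.1 i j) * r b := by
    intro a b
    have h1 : ∀ b, ((incl F n k).1 * x.1) a b = x.1 a b - c a * x.1 i b := by
      intro b
      simp [Matrix.mul_apply, hk, sub_mul, Finset.sum_sub_distrib, Matrix.one_apply,
        Pi.single_apply]
    rw [Units.val_mul, Units.val_mul, Matrix.mul_apply]
    simp only [h1, hu, mul_sub, Finset.sum_sub_distrib]
    simp [Matrix.one_apply, Pi.single_apply]
  refine ⟨incl F n k, ⟨k, rfl⟩, incl F n u, incl_mem_iwahori ?_, ?_, j, hj, i, ?_⟩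
  · intro a b hba
    rw [← incl_apply, hu]
    by_cases ha : a = j
    · subst ha
      simpa [hba.ne', hrb b hba.ne] using (hrow_lt b).2 hba
    · simp [hba.ne', ha]
  · intro i' j' hp
    obtain ⟨h1, h2⟩ := hrow i' j' hp
    have hjj : j' ≠ j := by rintro rfl; exact hj _ hp
    have hii : i' ≠ i := by rintro rfl; exact hne h2
    have hr0 : (r j' : F) = 0 := by rw [hrb j' hjj, h1, zero_div]
    have hc0 : (c i' : F) = 0 := by rw [hca i' hii, h2, zero_div]
    refine ⟨?_, fun a ha => ?_, fun b hb => ?_⟩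
    · rw [hY, hr0, hc0]; simpa using hp.1
    · rw [hY, hr0, h1, hp.2.1 a ha]; simp
    · rw [hY, hc0, h2, hp.2.2 b hb]; simp
  · refine ⟨?_, fun a ha => ?_, fun b hb => ?_⟩
    · rw [hY, hci, hrj]; simpa using hne
    · rw [hY, hrj, hca a ha, div_mul_cancel₀ _ hne]; simp
    · rw [hY, hci, hrb b hb]
      simp [mul_div_cancel₀ _ hne]

/-- The Bruhat decomposition `G = K W I`: up to `K` on the left and `I` on the right, every
invertible matrix is monomial. -/
theorem exists_monomial (x : GLF F n) :
    ∃ k ∈ maxCompact F n, ∃ u ∈ iwahori F n, ∃ σ : Equiv.Perm (Fin n), ∃ d : Fin n → F,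
      (∀ j, d j ≠ 0) ∧ ∀ i j, (k * x * u).1 i j = if i = σ j then d j else 0 := by
  classical
  suffices h : ∀ m, ∀ x : GLF F n,
      (Finset.univ.filter fun j => ∀ i, ¬ IsPivot x.1 i j).card = m →
      ∃ k ∈ maxCompact F n, ∃ u ∈ iwahori F n, ∀ j, ∃ i, IsPivot (k * x * u).1 i j by
    obtain ⟨k, hk, u, hu, hp⟩ := h _ x rfl
    choose σ hσ using hp
    have hinj : Function.Injective σ := by
      intro j j' hjj
      by_contra hne
      exact (hσ j').1 (hjj ▸ (hσ j).2.2 j' (Ne.symm hne))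
    refine ⟨k, hk, u, hu, Equiv.ofBijective σ (Finite.injective_iff_bijective.mp hinj),
      fun j => (k * x * u).1 (σ j) j, fun j => (hσ j).1, fun i j => ?_⟩
    rw [Equiv.ofBijective_apply]
    split_ifs with h
    · rw [h]
    · exact (hσ j).2.1 i h
  intro m
  induction m using Nat.strong_induction_on with
  | _ m ih =>
    intro x hm
    by_cases hx : ∃ j, ∀ i, ¬ IsPivot x.1 i j
    · obtain ⟨k, hk, u, hu, hold, j, hj, hnew⟩ := exists_isPivot_step x hx
      obtain ⟨k', hk', u', hu', h⟩ := ih _ (by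
        rw [← hm]
        refine Finset.card_lt_card (Finset.ssubset_iff_of_subset ?_ |>.mpr ⟨j, ?_, ?_⟩)
        · intro a ha
          simp only [Finset.mem_filter, Finset.mem_univ, true_and] at ha ⊢
          exact fun i hi => ha i (hold i a hi)
        · simpa using hj
        · simpa using hnew) (k * x * u) rfl
      refine ⟨k' * k, mul_mem hk' hk, u * u', mul_mem hu hu', ?_⟩
      simpa only [mul_assoc] using h
    · push Not at hx
      exact ⟨1, one_mem _, 1, one_mem _, by simpa using hx⟩

/-- The entries below the diagonal are replaced by exact zeros; the determinant stays a unit because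
the reduction is unchanged. Being merely in the maximal ideal would not suffice after conjugation by
a diagonal matrix of arbitrary valuations. -/
theorem exists_upper_triangular_lift {b : GLk F n} (hb : b ∈ borel F n) :
    ∃ k : Matrix.GeneralLinearGroup (Fin n) 𝒪[F], red F n k = b ∧ ∀ i j, j < i → k i j = 0 := by
  classical
  obtain ⟨k, hk⟩ := red_surjective F n b
  let M : Matrix (Fin n) (Fin n) 𝒪[F] := fun i j => if j < i then 0 else k i j
  have hM : M.map (IsLocalRing.residue 𝒪[F]) = b.1 := by
    ext i j
    by_cases hij : j < i
    · rw [Matrix.map_apply, show M i j = 0 from if_pos hij, map_zero, show b.1 i j = 0 from hb hij]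
    · rw [Matrix.map_apply, show M i j = k i j from if_neg hij, ← hk, red_apply]
  have hdet : IsUnit M.det := by
    refine isUnit_of_map_unit (IsLocalRing.residue 𝒪[F]) _ ?_
    rw [RingHom.map_det, RingHom.mapMatrix_apply, hM]
    exact (Matrix.isUnit_iff_isUnit_det _).mp b.isUnit
  refine ⟨M.nonsingInvUnit hdet, ?_, fun i j hij => ?_⟩
  · ext i j
    exact congrFun (congrFun hM i) j
  · exact if_pos hij

theorem exists_reindex_eq_conj {A : Type*} [Field A] (π : Equiv.Perm (Fin n)) :
    ∃ y : Matrix.GeneralLinearGroup (Fin n) A, ∀ b c : Matrix.GeneralLinearGroup (Fin n) A,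
      (∀ i j, c (π i) (π j) = b i j) → c = y * b * y⁻¹ := by
  let P : Matrix (Fin n) (Fin n) A := Equiv.Perm.permMatrix A π⁻¹
  have hP : P.det ≠ 0 := by
    rw [Matrix.det_permutation]
    rcases Int.units_eq_one_or (Equiv.Perm.sign π⁻¹) with h | h <;> simp [h]
  refine ⟨Matrix.GeneralLinearGroup.mkOfDetNeZero P hP, fun b c h => ?_⟩
  rw [eq_mul_inv_iff_mul_eq]
  refine Units.ext (Matrix.ext fun i j => ?_)
  obtain ⟨i, rfl⟩ := π.surjective i
  rw [Units.val_mul, Units.val_mul, Matrix.mul_apply, Matrix.mul_apply]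
  have hval : (Matrix.GeneralLinearGroup.mkOfDetNeZero P hP).1 = P := rfl
  have hP' : ∀ a b, P a b = if a = π b then 1 else 0 := by
    intro a b
    simp [P, Equiv.Perm.permMatrix, PEquiv.toMatrix_apply, eq_comm, Equiv.eq_symm_apply]
  simp only [hval, hP']
  simpa using h i j

/-- The image of `K ∩ x I x⁻¹` in `GL_n(k)` contains a conjugate of the Borel subgroup. -/
theorem exists_conj_borel (x : GLF F n) :
    ∃ y : GLk F n, ∀ b ∈ borel F n, ∃ k : Matrix.GeneralLinearGroup (Fin n) 𝒪[F],
      red F n k = y * b * y⁻¹ ∧ x⁻¹ * incl F n k * x ∈ iwahori F n := by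
  obtain ⟨_, ⟨k, rfl⟩, u, hu, σ, d, hd, hw⟩ := exists_monomial x
  -- The indices are ordered by decreasing valuation of d, with ties by increasing index.
  -- Conjugation by the monomial matrix multiplies the (i, j) entry by d j / d i; for i before j
  -- this factor is integral, and strictly less than 1 in valuation when j < i.
  let key : Fin n → Lex ((ValuativeRel.ValueGroupWithZero F)ᵒᵈ × Fin n) := fun i =>
    toLex (OrderDual.toDual (ValuativeRel.valuation F (d i)), i)
  let τ := Tuple.sort key
  have hτ : Monotone (key ∘ τ) := Tuple.monotone_sort key
  obtain ⟨y, hy⟩ := exists_reindex_eq_conj (n := n) (A := 𝓀[F]) (σ * τ)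
  refine ⟨(red F n k)⁻¹ * y, fun b hb => ?_⟩
  obtain ⟨c, hcb, hc⟩ := exists_upper_triangular_lift hb
  -- An integral matrix that is upper triangular for the sorted order, transported by σ.
  let c' : Matrix.GeneralLinearGroup (Fin n) 𝒪[F] :=
    Units.map (Matrix.reindexAlgEquiv 𝒪[F] 𝒪[F] (σ * τ)).toRingEquiv.toMonoidHom c
  have hc' : ∀ i j, c' ((σ * τ) i) ((σ * τ) j) = c i j := fun i j => by
    change c ((σ * τ).symm ((σ * τ) i)) ((σ * τ).symm ((σ * τ) j)) = c i j
    rw [Equiv.symm_apply_apply, Equiv.symm_apply_apply]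
  have hred : red F n c' = y * b * y⁻¹ := hy b (red F n c') fun i j => by
    rw [red_apply, hc', ← hcb, red_apply]
  have hzero : ∀ i j, key j < key i → c' (σ i) (σ j) = 0 := by
    intro i j hij
    have := hc' (τ.symm i) (τ.symm j)
    simp only [Equiv.Perm.coe_mul, Function.comp_apply, Equiv.apply_symm_apply] at this
    rw [this]
    refine hc _ _ (not_le.mp fun hle => hij.not_ge ?_)
    simpa using hτ hle
  have hval : ∀ i j, c' (σ i) (σ j) ≠ 0 → ValuativeRel.valuation F (d j / d i) ≤ 1 ∧
      (j < i → ValuativeRel.valuation F (d j / d i) < 1) := by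
    intro i j hij
    have hle : key i ≤ key j := not_lt.mp fun h => hij (hzero i j h)
    have h0 : 0 < ValuativeRel.valuation F (d i) := by simpa [zero_lt_iff] using hd i
    rw [Prod.Lex.toLex_le_toLex] at hle
    rw [map_div₀]
    rcases hle with h | h
    · have := (div_lt_one₀ h0).mpr h
      exact ⟨this.le, fun _ => this⟩
    · refine ⟨div_le_one_of_le₀ (OrderDual.toDual_inj.mp h.1).ge zero_le, fun hji => ?_⟩
      exact absurd h.2 (not_le.mpr hji)
  let t : Fin n → Fin n → F := fun i j => (c' (σ i) (σ j) : F) * (d j / d i)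
  have ht : ∀ i j, ValuativeRel.valuation F (t i j) ≤ 1 ∧
      (j < i → ValuativeRel.valuation F (t i j) < 1) := by
    intro i j
    by_cases hij : c' (σ i) (σ j) = 0
    · simp [t, hij]
    · have h1 : ValuativeRel.valuation F (c' (σ i) (σ j) : F) ≤ 1 := (c' (σ i) (σ j)).2
      simp only [t, map_mul]
      exact ⟨mul_le_one' h1 (hval i j hij).1,
        fun hji => (mul_le_of_le_one_left' h1).trans_lt ((hval i j hij).2 hji)⟩
  let T : Matrix (Fin n) (Fin n) 𝒪[F] := fun i j => ⟨t i j, (ht i j).1⟩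
  set w : GLF F n := incl F n k * x * u with hwdef
  have hwT : w.1 * (algebraMap 𝒪[F] F).mapMatrix T = (incl F n c').1 * w.1 := by
    ext i j
    obtain ⟨i, rfl⟩ := σ.surjective i
    rw [Matrix.mul_apply, Matrix.mul_apply]
    simp only [hw, incl_apply]
    have : ∀ a, (algebraMap 𝒪[F] F).mapMatrix T a j = t a j := fun _ => rfl
    simp only [this, t, EmbeddingLike.apply_eq_iff_eq, ite_mul, zero_mul, Finset.sum_ite_eq,
      Finset.mem_univ, if_true, mul_ite, mul_zero, Finset.sum_ite_eq']
    rw [mul_left_comm, mul_div_cancel₀ _ (hd i)]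
  -- T is w⁻¹ c' w, so it has the determinant of c' and is invertible over the integers.
  have hdet : T.det = c'.1.det := by
    have h := congrArg Matrix.det hwT
    rw [Matrix.det_mul, Matrix.det_mul, mul_comm, ← RingHom.map_det] at h
    have h' := mul_right_cancel₀ ((Matrix.isUnit_iff_isUnit_det _).mp w.isUnit).ne_zero h
    have h'' : (incl F n c').1.det = algebraMap 𝒪[F] F c'.1.det := by
      rw [RingHom.map_det]; rfl
    rw [h''] at h'
    exact Subtype.ext h'
  have hunit : IsUnit T.det := hdet ▸ (Matrix.isUnit_iff_isUnit_det _).mp c'.isUnit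
  have hT : w * incl F n (T.nonsingInvUnit hunit) = incl F n c' * w := Units.ext hwT
  refine ⟨k⁻¹ * c' * k, by simp [hred, mul_assoc], ?_⟩
  have hconj : x⁻¹ * incl F n (k⁻¹ * c' * k) * x =
      u * incl F n (T.nonsingInvUnit hunit) * u⁻¹ := by
    rw [eq_inv_mul_of_mul_eq hT, hwdef]
    simp [mul_assoc]
  rw [hconj]
  exact mul_mem (mul_mem hu (incl_mem_iwahori fun i j hij => (ht i j).2 hij)) (inv_mem hu)

end Elimination

/-! ### The annihilator of ind_B^G 1 for a finite group -/

section FiniteGroup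

variable {R : Type*} [Field R] {G : Type*} [Group G] [Fintype G] {B : Subgroup G}

/-- The coefficients of `z` sum to zero over the `h` with `h x B = y B`, for all `x` and `y`. -/
def CosetSumsVanish (B : Subgroup G) (z : MonoidAlgebra R G) : Prop :=
  open Classical in ∀ x y : G, ∑ h, (if (h * x)⁻¹ * y ∈ B then z.coeff h else 0) = 0

/-- Group the terms by the coset of B containing s h: φ is constant on it, and the coefficients
there sum to zero. -/
theorem sum_smul_comp_eq_zero {V : Type*} [AddCommGroup V] [Module R V] {φ : G → V}
    (hφ : ∀ g, ∀ b ∈ B, φ (g * b) = φ g) (c : G → R) (s : G → G)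
    (hc : open Classical in ∀ y : G, ∑ h, (if (s h)⁻¹ * y ∈ B then c h else 0) = 0) :
    ∑ h, c h • φ (s h) = 0 := by
  classical
  have hout : ∀ g : G, φ (g : G ⧸ B).out = φ g := by
    intro g
    obtain ⟨u, hu⟩ := QuotientGroup.mk_out_eq_mul B g
    rw [hu, hφ g _ u.2]
  have : Fintype (G ⧸ B) := Fintype.ofFinite _
  have h1 : ∀ h, c h • φ (s h) =
      ∑ q : G ⧸ B, (if (s h)⁻¹ * q.out ∈ B then c h else 0) • φ q.out := by
    intro h
    rw [Finset.sum_eq_single ((s h : G) : G ⧸ B)]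
    · rw [hout, if_pos]
      rw [← QuotientGroup.eq, QuotientGroup.out_eq']
    · intro q _ hq
      rw [if_neg, zero_smul]
      rw [← QuotientGroup.eq, QuotientGroup.out_eq']
      exact hq.symm
    · simp
  simp_rw [h1]
  rw [Finset.sum_comm]
  refine Finset.sum_eq_zero fun q _ => ?_
  rw [← Finset.sum_smul, hc, zero_smul]

theorem CosetSumsVanish.sum_smul_inv_mul {z : MonoidAlgebra R G} (hz : CosetSumsVanish B z)
    {φ : G → R} (hφ : ∀ g, ∀ b ∈ B, φ (g * b) = φ g) (y : G) :
    ∑ h, z.coeff h * φ (h⁻¹ * y) = 0 := by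
  classical
  refine sum_smul_comp_eq_zero (B := B) hφ z.coeff (fun h => h⁻¹ * y) fun x => ?_
  refine Eq.trans ?_ (hz x y)
  refine Finset.sum_congr rfl fun h _ => ?_
  rw [← B.inv_mem_iff]
  simp [mul_assoc]

/-- The condition is read off from the indicator functions of the cosets xB. -/
theorem cosetSumsVanish_of_forall {z : MonoidAlgebra R G}
    (hz : ∀ φ : G → R, (∀ g, ∀ b ∈ B, φ (g * b) = φ g) → ∀ y, ∑ h, z.coeff h * φ (h⁻¹ * y) = 0) :
    CosetSumsVanish B z := by
  classical
  intro x y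
  refine Eq.trans ?_ (hz (fun g => if x⁻¹ * g ∈ B then 1 else 0) (fun g b hb => by
    simp only [← mul_assoc, B.mul_mem_cancel_right hb]) y)
  simp [mul_assoc]

/-- The induced module is a space of coinvariants, spanned by classes δ g with δ (b g) = δ g, on
which h sends δ g to δ (g h⁻¹). The coset sums are the coefficients of z applied to these classes.
-/
theorem mem_annihilator_ind_trivial_iff (z : MonoidAlgebra R G) :
    z ∈ Module.annihilator (MonoidAlgebra R G)
      (Representation.ind B.subtype (Representation.trivial R B R)).asModule ↔
    CosetSumsVanish B z := by
  classical
  set ρ := Representation.ind B.subtype (Representation.trivial R B R) with hρ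
  let δ : G → Representation.IndV B.subtype (Representation.trivial R B R) := fun g =>
    Representation.IndV.mk _ _ g 1
  have hδ : ∀ g, ∀ b ∈ B, δ (b * g) = δ g := by
    intro g b hb
    have := Representation.Coinvariants.mk_self_apply (Representation.tprod
      ((Representation.leftRegular R G).comp B.subtype) (Representation.trivial R B R)) ⟨b, hb⟩
      (MonoidAlgebra.single g 1 ⊗ₜ[R] (1 : R))
    simpa [δ] using this
  have hact : ∀ v, ρ.asAlgebraHom z v = ∑ h, z.coeff h • ρ h v := by
    intro v
    rw [Representation.asAlgebraHom_def, MonoidAlgebra.lift_apply, Finsupp.sum_fintype _ _ (by simp)]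
    simp
  have hρδ : ∀ h g, ρ h (δ g) = δ (g * h⁻¹) := fun h g => Representation.ind_mk _ _ h g 1
  have hmem : z ∈ Module.annihilator (MonoidAlgebra R G) ρ.asModule ↔
      ∀ g, ∑ h, z.coeff h • δ (g * h⁻¹) = 0 := by
    rw [Module.mem_annihilator]
    constructor
    · intro h g
      have := h (ρ.asModuleEquiv.symm (δ g))
      rw [← ρ.asModuleEquiv.map_eq_zero_iff, Representation.asModuleEquiv_map_smul,
        LinearEquiv.apply_symm_apply, hact] at this
      simpa only [hρδ] using this
    · intro h m
      rw [← ρ.asModuleEquiv.map_eq_zero_iff, Representation.asModuleEquiv_map_smul]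
      have h0 : ρ.asAlgebraHom z = 0 := by
        refine Representation.IndV.hom_ext _ _ fun g => LinearMap.ext_ring ?_
        have := h g
        simp only [← hρδ, ← hact] at this
        simpa [δ] using this
      rw [h0, LinearMap.zero_apply]
  rw [hmem]
  constructor
  · intro h x y
    -- The indicator of the coset B y⁻¹ is left B-invariant, so it descends to a functional on
    -- coinvariants that extracts one coefficient.
    let φ : G → R := fun g => if g * y ∈ B then 1 else 0
    let L : Representation.IndV B.subtype (Representation.trivial R B R) →ₗ[R] R :=
      Representation.Coinvariants.lift _ (TensorProduct.lift
        ((Finsupp.lift _ R _ fun g => φ g • LinearMap.id) ∘ₗ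
          (MonoidAlgebra.coeffLinearEquiv R).toLinearMap)) fun b => by
        ext g
        simp [φ, mul_assoc, B.mul_mem_cancel_left b.2]
    have hL : ∀ g, L (δ g) = φ g := fun g => by simp [L, δ]
    have := congrArg L (h x⁻¹)
    simpa [hL, φ, mul_assoc] using this
  · intro hz g
    have := sum_smul_comp_eq_zero (B := B) (φ := fun g => δ g⁻¹) (fun g b hb => by
      rw [mul_inv_rev]; exact hδ _ _ (B.inv_mem hb)) z.coeff (fun h => h * g⁻¹) (hz g⁻¹)
    simpa using this

end FiniteGroup

/-! ### Inflation from R[GL_n(k)] to H(K), and its action on ind_I^G 1 -/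

section Inflation

variable {F : Type*} [Field F] [ValuativeRel F] [TopologicalSpace F] [IsNonarchimedeanLocalField F]
  {n : ℕ} {R : Type*} [Field R]

instance : Fintype (GLk F n) := Fintype.ofFinite _

/-- A lift of an element of `GL_n(k)` to `K`. -/
def lift (h : GLk F n) : GLF F n := incl F n (Function.surjInv (red_surjective F n) h)

theorem lift_mem (h : GLk F n) : lift h ∈ maxCompact F n := ⟨_, rfl⟩

theorem lift_inv_mul_incl_mem_iff (h : GLk F n) (k : Matrix.GeneralLinearGroup (Fin n) 𝒪[F]) :
    (lift h)⁻¹ * incl F n k ∈ proRadical F n ↔ h = red F n k := by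
  rw [lift, ← map_inv, ← map_mul, incl_mem_proRadical, map_mul, map_inv, Function.surjInv_eq (red_surjective F n),
    inv_mul_eq_one]

theorem incl_inv_mul_lift_red_mem (k : Matrix.GeneralLinearGroup (Fin n) 𝒪[F]) :
    (incl F n k)⁻¹ * lift (red F n k) ∈ proRadical F n := by
  have := inv_mem ((lift_inv_mul_incl_mem_iff (red F n k) k).mpr rfl)
  simpa using this

variable (R) in
/-- The indicator function of `x K¹`. -/
def cosetFn (x : GLF F n) : HeckeAlgebra R (GLF F n) :=
  ⟨fun y => Set.indicator (proRadical F n : Set (GLF F n)) 1 (x⁻¹ * y),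
    translate_mem (indicator_mem (isOpen_proRadical F n) (isCompact_proRadical F n)) x⟩

/-- The inflation of `z ∈ R[GL_n(k)]` to a function supported on `K`. -/
def inflation (z : MonoidAlgebra R (GLk F n)) : HeckeAlgebra R (GLF F n) :=
  ⟨∑ h, z.coeff h • (cosetFn R (lift h)).1,
    Submodule.sum_mem _ fun h _ => Submodule.smul_mem _ _ (cosetFn R (lift h)).2⟩

theorem inflation_incl (z : MonoidAlgebra R (GLk F n))
    (k : Matrix.GeneralLinearGroup (Fin n) 𝒪[F]) :
    (inflation z).1 (incl F n k) = z.coeff (red F n k) := by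
  classical
  simp only [inflation, cosetFn, Finset.sum_apply, Pi.smul_apply, Set.indicator_apply,
    SetLike.mem_coe, lift_inv_mul_incl_mem_iff, Pi.one_apply]
  simp

theorem inflation_of_notMem (z : MonoidAlgebra R (GLk F n)) {x : GLF F n}
    (hx : x ∉ maxCompact F n) : (inflation z).1 x = 0 := by
  simp only [inflation, cosetFn, Finset.sum_apply, Pi.smul_apply]
  refine Finset.sum_eq_zero fun h _ => ?_
  rw [Set.indicator_of_notMem, smul_zero]
  intro hm
  exact hx (((maxCompact F n).mul_mem_cancel_left (inv_mem (lift_mem h))).mp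
    (proRadical_le F n hm))

theorem inflation_mem_heckeK (z : MonoidAlgebra R (GLk F n)) : inflation z ∈ heckeK F n R := by
  intro x hx
  by_contra h
  exact hx (inflation_of_notMem z h)

theorem inflation_mul_right (z : MonoidAlgebra R (GLk F n)) (g : GLF F n) {u : GLF F n}
    (hu : u ∈ proRadical F n) : (inflation z).1 (g * u) = (inflation z).1 g := by
  by_cases hg : g ∈ maxCompact F n
  · obtain ⟨k, rfl⟩ := hg
    obtain ⟨v, hv, rfl⟩ := hu
    rw [← map_mul, inflation_incl, inflation_incl, map_mul, (MonoidHom.mem_ker).mp hv, mul_one]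
  · rw [inflation_of_notMem z hg, inflation_of_notMem]
    rwa [(maxCompact F n).mul_mem_cancel_right (proRadical_le F n hu)]

theorem inflation_mul_left (z : MonoidAlgebra R (GLk F n)) (g : GLF F n) {u : GLF F n}
    (hu : u ∈ proRadical F n) : (inflation z).1 (u * g) = (inflation z).1 g := by
  by_cases hg : g ∈ maxCompact F n
  · obtain ⟨k, rfl⟩ := hg
    obtain ⟨v, hv, rfl⟩ := hu
    rw [← map_mul, inflation_incl, inflation_incl, map_mul, (MonoidHom.mem_ker).mp hv, one_mul]
  · rw [inflation_of_notMem z hg, inflation_of_notMem]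
    rwa [(maxCompact F n).mul_mem_cancel_left (proRadical_le F n hu)]

theorem toFinite_inflation (h₀ : IsNormalizing R (proRadical F n))
    (z : MonoidAlgebra R (GLk F n)) : toFinite F n R (inflation z) = z := by
  have e1 : convolution R (proRadical F n)
      (Set.indicator (proRadical F n : Set (GLF F n)) 1) (inflation z).1 = (inflation z).1 := by
    have := convolution_indicator_left h₀ (isCompact_proRadical F n)
      (fun g u hu => inflation_mul_left z g hu) 1
    simpa using this
  have e2 := convolution_indicator_right h₀ (isCompact_proRadical F n)
    (fun g u hu => inflation_mul_right z g hu)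
  refine MonoidAlgebra.coeff_injective (Finsupp.ext fun g => ?_)
  simp only [toFinite, e1, e2]
  change (inflation z).1 (incl F n _) = _
  rw [inflation_incl, Function.surjInv_eq (red_surjective F n)]

/-- The balancing relation for the element infl z of H(K), whose image in R[G_f] is z itself. It
moves the finite factor into the Hecke algebra. -/
theorem tmul_mul_inflation (h₀ : IsNormalizing R (proRadical F n))
    (f : HeckeAlgebra R (GLF F n)) (z : MonoidAlgebra R (GLk F n)) :
    tmul F n R (HeckeAlgebra.mul (proRadical F n) f (inflation z)) 1 = tmul F n R f z := by
  rw [tmul, tmul, ← sub_eq_zero, ← map_sub, Submodule.mkQ_apply, Submodule.Quotient.mk_eq_zero]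
  refine Submodule.subset_span ⟨f, inflation z, inflation_mem_heckeK z, 1, ?_⟩
  rw [toFinite_inflation h₀, mul_one]

theorem mul_cosetFn_inflation (h₀ : IsNormalizing R (proRadical F n)) (x : GLF F n)
    (z : MonoidAlgebra R (GLk F n)) :
    (HeckeAlgebra.mul (proRadical F n) (cosetFn R x) (inflation z)).1 =
      fun y => (inflation z).1 (x⁻¹ * y) :=
  convolution_indicator_left h₀ (isCompact_proRadical F n)
    (fun g _ hu => inflation_mul_left z g hu) x

section Action

variable {V : Type*} [AddCommGroup V] [Module R V] {ρ : Representation R (GLF F n) V} {v : V}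

/-- The inflation first projects v to the K¹-invariants and then acts there through lifts of
elements of G_f. -/
theorem act_inflation (h₀ : IsNormalizing R (proRadical F n)) (hv : IsSmooth ρ v)
    (z : MonoidAlgebra R (GLk F n)) :
    act R (proRadical F n) ρ (inflation z).1 v = ∑ h, z.coeff h • ρ (lift h)
      (act R (proRadical F n) ρ (Set.indicator (proRadical F n : Set (GLF F n)) 1) v) := by
  rw [inflation, act_sum_smul h₀ hv _ _ fun h _ => (cosetFn R (lift h)).2]
  refine Finset.sum_congr rfl fun h _ => ?_
  rw [cosetFn, act_translate h₀ hv
    (indicator_mem (isOpen_proRadical F n) (isCompact_proRadical F n))]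

end Action

/-- The inflation of an element of the annihilator of `ind_{B_f}^{G_f} 1` annihilates
`ind_I^G 1`. -/
theorem act_inflation_eq_zero (h₀ : IsNormalizing R (proRadical F n))
    {z : MonoidAlgebra R (GLk F n)} (hz : CosetSumsVanish (borel F n) z)
    (v : CompactInd R (iwahori F n)) :
    act R (proRadical F n) (compactInd R (iwahori F n)) (inflation z).1 v = 0 := by
  have hv := isSmooth_compactInd (iwahori F n) v
  rw [act_inflation h₀ hv]
  have hfix := fun u (hu : u ∈ proRadical F n) =>
    apply_act_indicator h₀ (isCompact_proRadical F n) hv hu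
  set w := act R (proRadical F n) (compactInd R (iwahori F n))
    (Set.indicator (proRadical F n : Set (GLF F n)) 1) v
  have hw : ∀ u ∈ proRadical F n, ∀ x, w.1 (u * x) = w.1 x := by
    intro u hu x
    have := congrArg (fun w : CompactInd R (iwahori F n) => w.1 x) (hfix u⁻¹ (inv_mem hu))
    simpa [compactInd] using this
  have hwk : ∀ (k k' : Matrix.GeneralLinearGroup (Fin n) 𝒪[F]) x, red F n k = red F n k' →
      w.1 (incl F n k * x) = w.1 (incl F n k' * x) := by
    intro k k' x hkk
    have : incl F n (k' * k⁻¹) ∈ proRadical F n := by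
      rw [incl_mem_proRadical, map_mul, map_inv, hkk, mul_inv_cancel]
    rw [← hw _ this, ← mul_assoc, ← map_mul, inv_mul_cancel_right]
  refine Subtype.ext (funext fun x => ?_)
  obtain ⟨y, hy⟩ := exists_conj_borel x
  -- The restriction of w to Kx, seen on G_f. The shift by y⁻¹ turns invariance under y B_f y⁻¹ into
  -- invariance under B_f.
  let φ : GLk F n → R := fun g => w.1 (lift (g * y⁻¹) * x)
  have hφ : ∀ g, ∀ b ∈ borel F n, φ (g * b) = φ g := by
    intro g b hb
    obtain ⟨k, hk, hI⟩ := hy b hb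
    have h1 : φ (g * b) = w.1 (lift (g * y⁻¹) * incl F n k * x) := by
      simp only [φ, lift, ← map_mul]
      refine hwk _ _ _ ?_
      rw [map_mul, Function.surjInv_eq (red_surjective F n), Function.surjInv_eq (red_surjective F n), hk]
      simp [mul_assoc]
    rw [h1, show lift (g * y⁻¹) * incl F n k * x =
      lift (g * y⁻¹) * x * (x⁻¹ * incl F n k * x) by simp [mul_assoc]]
    exact w.2.1 _ _ hI
  have key := hz.sum_smul_inv_mul hφ y
  have e : ∀ h : GLk F n, φ (h⁻¹ * y) = w.1 ((lift h)⁻¹ * x) := by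
    intro h
    simp only [φ, lift, mul_inv_cancel_right, ← map_inv]
    refine hwk _ _ _ ?_
    rw [Function.surjInv_eq (red_surjective F n), map_inv, Function.surjInv_eq (red_surjective F n)]
  simp only [e] at key
  simpa [compactInd] using key

end Inflation

/-! ### Comparing the two annihilators -/

section Main

variable {F : Type*} [Field F] [ValuativeRel F] [TopologicalSpace F] [IsNonarchimedeanLocalField F]
  {n : ℕ} {R : Type*} [Field R]

theorem mul_inflation_mem_annP_of_mem_annPf (h₀ : IsNormalizing R (proRadical F n))
    (f : HeckeAlgebra R (GLF F n)) {z : MonoidAlgebra R (GLk F n)} (hz : z ∈ annPf F n R) :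
    HeckeAlgebra.mul (proRadical F n) f (inflation z) ∈ annP F n R := by
  intro v
  rw [annPf, mem_annihilator_ind_trivial_iff] at hz
  refine (act_convolution h₀ (isSmooth_compactInd _ v) f.2 (inflation z).2).trans ?_
  rw [act_inflation_eq_zero h₀ hz, act]
  simp only [map_zero, smul_zero]
  exact haarIntegral_zero

theorem mul_inflation_mem_annP (h₀ : IsNormalizing R (proRadical F n))
    {f : HeckeAlgebra R (GLF F n)} (hf : f ∈ annP F n R) (z : MonoidAlgebra R (GLk F n)) :
    HeckeAlgebra.mul (proRadical F n) f (inflation z) ∈ annP F n R := fun v =>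
  (act_convolution h₀ (isSmooth_compactInd _ v) f.2 (inflation z).2).trans (hf _)

/-- The element of `R[GL_n(k)]` with the given coefficients. -/
def ofFn (φ : GLk F n → R) : MonoidAlgebra R (GLk F n) :=
  MonoidAlgebra.ofCoeff (Finsupp.equivFunOnFinite.symm φ)

/-- Functions on G_f/B_f, pulled back to K and extended by zero, form a copy of the finite induced
representation inside ind_I^G 1. -/
theorem inflation_ofFn_mem_compactInd {φ : GLk F n → R}
    (hφ : ∀ g, ∀ b ∈ borel F n, φ (g * b) = φ g) :
    (inflation (ofFn φ)).1 ∈ CompactInd R (iwahori F n) := by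
  have hle : iwahori F n ≤ maxCompact F n := by
    rintro _ ⟨k, -, rfl⟩
    exact ⟨k, rfl⟩
  refine ⟨fun g u hu => ?_, ⟨proRadical F n, isOpen_proRadical F n,
    fun u hu g => inflation_mul_left _ g hu⟩, maxCompact F n, isCompact_maxCompact F n,
    fun x hx => ⟨x, inflation_mem_heckeK _ hx, 1, one_mem (iwahori F n), mul_one x⟩⟩
  by_cases hg : g ∈ maxCompact F n
  · obtain ⟨k, rfl⟩ := hg
    obtain ⟨b, hb, rfl⟩ := hu
    rw [← map_mul, inflation_incl, inflation_incl, map_mul]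
    exact hφ _ _ hb
  · rw [inflation_of_notMem _ hg, inflation_of_notMem]
    rwa [(maxCompact F n).mul_mem_cancel_right (hle hu)]

theorem act_inflation_inflation_apply (h₀ : IsNormalizing R (proRadical F n))
    (z : MonoidAlgebra R (GLk F n)) {φ : GLk F n → R}
    (hφ : ∀ g, ∀ b ∈ borel F n, φ (g * b) = φ g) (x : GLF F n) :
    (act R (proRadical F n) (compactInd R (iwahori F n)) (inflation z).1
      ⟨_, inflation_ofFn_mem_compactInd hφ⟩).1 x =
      ∑ h, z.coeff h * (inflation (ofFn φ)).1 ((lift h)⁻¹ * x) := by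
  rw [act_inflation h₀ (isSmooth_compactInd _ _),
    act_indicator_of_fixed h₀ (isCompact_proRadical F n)]
  · simp [compactInd]
  · intro u hu
    exact Subtype.ext (funext fun x => inflation_mul_left _ x (inv_mem hu))

/-- A right `K¹`-invariant element of the annihilator of `ind_I^G 1` is a sum of translates of
inflations of elements of the annihilator of `ind_{B_f}^{G_f} 1`. -/
theorem exists_eq_sum_of_mem_annP (h₀ : IsNormalizing R (proRadical F n))
    {f : HeckeAlgebra R (GLF F n)} (hf : f ∈ annP F n R)
    (hinv : ∀ g, ∀ u ∈ proRadical F n, f.1 (g * u) = f.1 g) :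
    ∃ (T : Finset (GLF F n ⧸ maxCompact F n))
      (w : GLF F n ⧸ maxCompact F n → MonoidAlgebra R (GLk F n)),
      (∀ q ∈ T, w q ∈ annPf F n R) ∧
      f = ∑ q ∈ T, HeckeAlgebra.mul (proRadical F n) (cosetFn R q.out) (inflation (w q)) := by
  classical
  have : DiscreteTopology (GLF F n ⧸ maxCompact F n) :=
    QuotientGroup.discreteTopology (isOpen_maxCompact F n)
  have hfin : ((fun g : GLF F n => (g : GLF F n ⧸ maxCompact F n)) '' tsupport f.1).Finite :=
    isCompact_iff_finite.mp (f.2.2.isCompact.image QuotientGroup.continuous_mk)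
  -- The restriction of f to the coset q, translated back to K; right K¹-invariance lets it descend
  -- to G_f.
  let w : GLF F n ⧸ maxCompact F n → MonoidAlgebra R (GLk F n) := fun q =>
    ofFn fun h => f.1 (q.out * lift h)
  have hout : ∀ (q : GLF F n ⧸ maxCompact F n) (y : GLF F n),
      q.out⁻¹ * y ∈ maxCompact F n ↔ q = y := by
    intro q y
    rw [← QuotientGroup.eq, QuotientGroup.out_eq']
  have hsum : f.1 = ∑ q ∈ hfin.toFinset, fun y => (inflation (w q)).1 (q.out⁻¹ * y) := by
    funext y
    rw [Finset.sum_apply, Finset.sum_eq_single (y : GLF F n ⧸ maxCompact F n)]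
    · obtain ⟨k, hk⟩ := (hout y y).mpr rfl
      rw [← hk, inflation_incl]
      have hy : y = (y : GLF F n ⧸ maxCompact F n).out * incl F n k := by rw [hk]; simp
      change f.1 y = f.1 ((y : GLF F n ⧸ maxCompact F n).out * lift (red F n k))
      rw [← hinv y _ (incl_inv_mul_lift_red_mem k)]
      nth_rw 1 [hy]
      simp [mul_assoc]
    · intro q _ hq
      exact inflation_of_notMem _ fun h => hq ((hout q y).mp h)
    · intro hy
      obtain ⟨k, hk⟩ := (hout y y).mpr rfl
      rw [← hk, inflation_incl]
      by_contra hne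
      have hmem := subset_tsupport f.1 (show _ ∈ Function.support f.1 from hne)
      refine hy ((Set.Finite.mem_toFinset _).mpr ⟨_, hmem, ?_⟩)
      rw [eq_comm, ← hout, inv_mul_cancel_left]
      exact lift_mem _
  refine ⟨hfin.toFinset, w, fun q₀ hq₀ => ?_, ?_⟩
  · rw [annPf, mem_annihilator_ind_trivial_iff]
    refine cosetSumsVanish_of_forall fun φ hφ y => ?_
    let Φ : CompactInd R (iwahori F n) := ⟨_, inflation_ofFn_mem_compactInd hφ⟩
    have hact : act R (proRadical F n) (compactInd R (iwahori F n)) f.1 Φ =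
        ∑ q ∈ hfin.toFinset, compactInd R (iwahori F n) q.out
          (act R (proRadical F n) (compactInd R (iwahori F n)) (inflation (w q)).1 Φ) := by
      have := act_sum_smul h₀ (isSmooth_compactInd _ Φ) hfin.toFinset (fun _ => (1 : R))
        (f := fun q y => (inflation (w q)).1 (q.out⁻¹ * y))
        fun q _ => translate_mem (inflation (w q)).2 q.out
      simp only [one_smul] at this
      rw [← hsum] at this
      rw [this]
      exact Finset.sum_congr rfl fun q _ =>
        act_translate h₀ (isSmooth_compactInd _ Φ) (inflation (w q)).2 q.out
    -- Since Φ is supported on K, the term of q is supported on the coset q. Evaluating at a point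
    -- of q₀ isolates the action of w q₀ on φ.
    have hzero := congrArg (fun v : CompactInd R (iwahori F n) => v.1 (q₀.out * lift y))
      (hact.symm.trans (hf Φ))
    simp only [Submodule.coe_sum, Finset.sum_apply] at hzero
    have hterm : ∀ q : GLF F n ⧸ maxCompact F n, (compactInd R (iwahori F n) q.out
        (act R (proRadical F n) (compactInd R (iwahori F n)) (inflation (w q)).1 Φ)).1
          (q₀.out * lift y) = ∑ h, (w q).coeff h *
            (inflation (ofFn φ)).1 ((lift h)⁻¹ * (q.out⁻¹ * (q₀.out * lift y))) := fun q =>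
      act_inflation_inflation_apply h₀ (w q) hφ (q.out⁻¹ * (q₀.out * lift y))
    simp only [hterm] at hzero
    rw [Finset.sum_eq_single q₀ ?_ (fun h => absurd hq₀ h)] at hzero
    · rw [inv_mul_cancel_left] at hzero
      refine Eq.trans (Finset.sum_congr rfl fun h _ => ?_) hzero
      rw [lift, lift, ← map_inv, ← map_mul, inflation_incl, map_mul, map_inv,
        Function.surjInv_eq (red_surjective F n), Function.surjInv_eq (red_surjective F n)]
      rfl
    · intro q _ hq
      refine Finset.sum_eq_zero fun h _ => ?_
      rw [inflation_of_notMem, mul_zero]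
      intro hm
      rw [(maxCompact F n).mul_mem_cancel_left (inv_mem (lift_mem h)), ← mul_assoc,
        (maxCompact F n).mul_mem_cancel_right (lift_mem y), hout, QuotientGroup.out_eq'] at hm
      exact hq hm
  · refine Subtype.ext (hsum.trans ?_)
    refine Eq.trans (Finset.sum_congr rfl fun q _ => ?_)
      (Submodule.coe_sum (heckeSubmodule R (GLF F n)) _ hfin.toFinset).symm
    exact (mul_cosetFn_inflation h₀ q.out (w q)).symm

theorem mul_inflation_mul_right (f : HeckeAlgebra R (GLF F n)) (z : MonoidAlgebra R (GLk F n))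
    (g : GLF F n) {u : GLF F n} (hu : u ∈ proRadical F n) :
    (HeckeAlgebra.mul (proRadical F n) f (inflation z)).1 (g * u) =
      (HeckeAlgebra.mul (proRadical F n) f (inflation z)).1 g := by
  simp only [HeckeAlgebra.mul, convolution, ← mul_assoc, inflation_mul_right z _ hu]

theorem tmul_sum {ι : Type*} (s : Finset ι) (f : ι → HeckeAlgebra R (GLF F n))
    (z : MonoidAlgebra R (GLk F n)) :
    tmul F n R (∑ i ∈ s, f i) z = ∑ i ∈ s, tmul F n R (f i) z := by
  simp only [tmul, TensorProduct.sum_tmul, map_sum]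

end Main

end Hecke

end

theorem mainTheorem3 (F : Type*) [Field F] [ValuativeRel F] [TopologicalSpace F]
    [IsNonarchimedeanLocalField F] (n : ℕ) (R : Type*) [Field R] [IsAlgClosed R]
    (p l : ℕ) [CharP 𝓀[F] p] [CharP R l] (hlp : l ≠ p) :
    Hecke.tensorSpan F n R Set.univ (Hecke.annPf F n R : Set (MonoidAlgebra R (Hecke.GLk F n))) =
      Hecke.tensorSpan F n R (Hecke.annP F n R) Set.univ := by
  have h₀ : Hecke.IsNormalizing R (Hecke.proRadical F n) :=
    Hecke.isNormalizing_proRadical F n R hlp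
  apply le_antisymm <;> refine Submodule.span_le.mpr ?_
  · rintro _ ⟨f, -, z, hz, rfl⟩
    rw [← Hecke.tmul_mul_inflation h₀]
    exact Submodule.subset_span
      ⟨_, Hecke.mul_inflation_mem_annP_of_mem_annPf h₀ f hz, 1, trivial, rfl⟩
  · rintro _ ⟨f, hf, z, -, rfl⟩
    obtain ⟨T, w, hw, hsum⟩ := Hecke.exists_eq_sum_of_mem_annP h₀
      (Hecke.mul_inflation_mem_annP h₀ hf z)
      (fun g u hu => Hecke.mul_inflation_mul_right f z g hu)
    -- The tensor is absorbed into the first factor, split along cosets of K, and each w q is then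
    -- moved back to the second factor.
    rw [← Hecke.tmul_mul_inflation h₀, hsum, Hecke.tmul_sum]
    refine Submodule.sum_mem _ fun q hq => ?_
    rw [Hecke.tmul_mul_inflation h₀]
    exact Submodule.subset_span ⟨_, trivial, w q, hw q hq, rfl⟩
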